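/- **Setting.** Let $\mathbb K$ be a totally real number field of degree $d$ with ring of integers $\mathcal O$ and different $\partial$; let $n>1$ and $k\in\mathbb Z$. All fractional ideals are nonzero, $\alpha\gg0$ means that $\alpha$ is totally positive, and $M^{(\sigma)}$ is the image of a matrix $M$ over $\mathbb K$ under an embedding $\sigma:\mathbb K\to\mathbb R$. Let $\mathcal H_{(n)}$ be the Siegel upper half-space of degree $n$. For fractional ideals $\mathcal I_1,\dots,\mathcal I_n,\mathcal J$, let $\Gamma(\mathcal I_1,\dots,\mathcal I_n;\mathcal J)$ be the group of invertible matrices $\begin{pmatrix}A&B\\C&D\end{pmatrix}$ over $\mathbb K$, in $n\times n$ blocks, with $A\,{}^tB$ and $C\,{}^tD$ symmetric, $A\,{}^tD-B\,{}^tC=uI$ for a totally positive unit $u$, $a_{ij}\in\mathcal I_i\mathcal I_j^{-1}$, $b_{ij}\in\mathcal I_i\mathcal I_j\mathcal J\partial^{-1}$, $c_{ij}\in(\mathcal I_i\mathcal I_j\mathcal J)^{-1}\partial$, $d_{ij}\in\mathcal I_i^{-1}\mathcal I_j$. For $f:\mathcal H_{(n)}^d\to\mathbb C$ put $$f\Big|\begin{pmatrix}A&B\\C&D\end{pmatrix}(\tau)=\Big(\prod_\sigma\det(A\,{}^tD-B\,{}^tC)^{(\sigma)}\Big)^{k/2}\prod_\sigma\det\big(C^{(\sigma)}\tau_\sigma+D^{(\sigma)}\big)^{-k}f\big((A\tau+B)(C\tau+D)^{-1}\big).$$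 The space $\mathcal M_k(\Gamma)$, for such a group $\Gamma$, consists of the functions $f$ with $f|M=f$ for all $M\in\Gamma$ that have, for all $\tau\in\mathcal H_{(n)}^d$, an (absolutely convergent) expansion $$f(\tau)=\sum_Tc_f(T)\exp\Big(\pi i\sum_\sigma\operatorname{tr}(T^{(\sigma)}\tau_\sigma)\Big),$$ $T$ running over the symmetric $n\times n$ matrices over $\mathbb K$ all of whose real conjugates are positive semi-definite. Consider the following maps between the spaces $\mathcal M_k(\Gamma(\mathcal I_1,\dots,\mathcal I_n;\mathcal J))$, which change the tuple $(\mathcal I_1,\dots,\mathcal I_n;\mathcal J)$ as indicated: * $U_\ell(\alpha)$, $\alpha\in\mathbb K^\times$: $f\mapsto f|\operatorname{diag}(M,{}^tM^{-1})$ where $M$ is the identity with $\ell$-th diagonal entry replaced by $\alpha^{-1}$; here $\mathcal I_\ell\mapsto\alpha\mathcal I_\ell$. * $W(\alpha)$, $\alpha\gg0$: $f\mapsto f|\operatorname{diag}(\alpha^{-1}I,I)$; here $\mathcal J\mapsto\alpha\mathcal J$. * $V_\ell(\mathcal Q)$, $\mathcal Q$ a fractional ideal, $1\le\ell<n$: $f\mapsto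 f|\operatorname{diag}(M,{}^tM^{-1})$ where $M$ is the identity with the block in rows and columns $\ell,\ell+1$ replaced by a matrix $A\in\begin{pmatrix}\mathcal Q^{-1}&\mathcal Q\mathcal I_\ell\mathcal I_{\ell+1}^{-1}\\\mathcal Q^{-1}\mathcal I_\ell^{-1}\mathcal I_{\ell+1}&\mathcal Q\end{pmatrix}$ with $\det A=1$; here $\mathcal I_\ell\mapsto\mathcal Q\mathcal I_\ell$, $\mathcal I_{\ell+1}\mapsto\mathcal Q^{-1}\mathcal I_{\ell+1}$. Call two forms, each taken together with its tuple, *equivalent* if a composition of these maps takes one to the other. A *family* $F$ assigns to every tuple $(\mathcal I_1,\dots,\mathcal I_n;\mathcal J)$ a form in $\mathcal M_k(\Gamma(\mathcal I_1,\dots,\mathcal I_n;\mathcal J))$ so that the forms at any two tuples connected by such maps are equivalent. A *representative* of the component of $F$ at a tuple is a form at this tuple that is equivalent to the one assigned by $F$. We write $F\in\mathcal M_k$ if moreover $F$ assigns the same form to two tuples that define the same group, such as $(\mathcal I_1,\dots,\mathcal I_n;\mathcal Q^2\mathcal J)$ and $(\mathcal Q\mathcal I_1,\dots,\mathcal Q\mathcal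 I_n;\mathcal J)$. Let $V$ be an $n$-dimensional $\mathbb K$-space with a symmetric bilinear form $B$ such that $B(v,v)$ is nonnegative under every real embedding for all $v\in V$. Let $\Lambda$ be a lattice on $V$ (a finitely generated $\mathcal O$-submodule spanning $V$) and $\mathcal J$ a fractional ideal such that $\Lambda^{\mathcal J}$ is even integral, i.e. $B(v,v)\in2\mathcal J^{-1}$ for all $v\in\Lambda$. If $k$ is odd, let $\Lambda$ also be equipped with an orientation, i.e. a class of bases of $V$ modulo changes of basis of totally positive determinant. Put $$c(\Lambda^{\mathcal J})=c_F(\Lambda^{\mathcal J})=c_f(T)\,N(\mathcal I_1\cdots\mathcal I_n)^k\,N(\mathcal J)^{nk/2},\qquad T=(B(x_i,x_j)),$$ where $\Lambda=\mathcal I_1x_1\oplus\cdots\oplus\mathcal I_nx_n$ with fractional ideals $\mathcal I_i$ and a basis $(x_i)$ of $V$ (in the given orientation if $k$ is odd), and $f\in\mathcal M_k(\Gamma(\mathcal I_1,\dots,\mathcal I_n;\mathcal J))$ is a representative of the component of $F$ at $(\mathcal I_1,\dots,\mathcal I_n;\mathcal J)$. **Proposition 2.2.** The Fourier coefficient $c(\Lambda^{\mathcal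 J})$ is well defined. More precisely: 1. For every family $F$, in particular for every $F\in\mathcal M_k$, there are $x_i,\mathcal I_i,f$ as above, and the value $c_F(\Lambda^{\mathcal J})$ is the same for all choices of the basis $(x_i)$, the coefficient ideals $\mathcal I_i$, the representative $f$ and its Fourier expansion. 2. For every family $F$ and every $\alpha\gg0$, $c_F(\Lambda^{\mathcal J})=c_F(\Lambda'^{\,\alpha\mathcal J})$, where $\Lambda'$ is the (oriented) lattice $\Lambda$ with the form $\alpha^{-1}B$. 3. For every $F\in\mathcal M_k$ the value is independent of the representative of the strict ideal complex of $\mathcal J$: if $\mathcal J'=\alpha\mathcal Q^2\mathcal J$ with $\alpha\gg0$ and $\mathcal Q$ a fractional ideal, then $c_F(\Lambda^{\mathcal J})=c_F(\Lambda'^{\,\mathcal J'})$, where $\Lambda'$ is the lattice $\mathcal Q^{-1}\Lambda$ with the form $\alpha^{-1}B$ (and the same orientation). -/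

import Mathlib

open NumberField nonZeroDivisors

noncomputable section

namespace HilbertSiegel

/-- The group of (nonzero) fractional ideals of `K`. -/
abbrev FracIdeal (K : Type*) [Field K] [NumberField K] : Type _ :=
  (FractionalIdeal (𝓞 K)⁰ K)ˣ

/-- `a ≫ 0`: every real embedding of `a` is positive. -/
def TotPos {K : Type*} [Field K] (a : K) : Prop :=
  ∀ σ : K →+* ℝ, 0 < σ a

section UpperHalfSpace

/-- The Siegel upper half-space of degree `n`. -/
abbrev SiegelSpace (n : ℕ) : Type :=
  {τ : Matrix (Fin n) (Fin n) ℂ // τ.IsSymm ∧ (τ.map Complex.im).PosDef}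

/-- The product of `d` copies of Siegel upper half-space, one for each embedding `K → ℝ`. -/
abbrev HalfSpace (K : Type*) [Field K] (n : ℕ) : Type _ :=
  (K →+* ℝ) → SiegelSpace n

/-- The image `M^{(σ)}` of a matrix over `K` under a real embedding, as a complex matrix. -/
def conjMatrix {K : Type*} [Field K] {m l : Type*} (σ : K →+* ℝ) (M : Matrix m l K) :
    Matrix m l ℂ :=
  M.map fun a => ((σ a : ℝ) : ℂ)

/-- `(A τ + B) (C τ + D)⁻¹`, in the coordinate `σ`, where `M` has the `n × n` blocks
`A, B, C, D`. -/
def moebius {K : Type*} [Field K] {n : ℕ} (M : Matrix (Fin n ⊕ Fin n) (Fin n ⊕ Fin n) K)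
    (τ : HalfSpace K n) (σ : K →+* ℝ) : Matrix (Fin n) (Fin n) ℂ :=
  (conjMatrix σ M.toBlocks₁₁ * (τ σ).1 + conjMatrix σ M.toBlocks₁₂) *
    (conjMatrix σ M.toBlocks₂₁ * (τ σ).1 + conjMatrix σ M.toBlocks₂₂)⁻¹

open Classical in
/-- The weight `k` operator
`f|M (τ) = det N(A ᵗD - B ᵗC)^{k/2} det N(C τ + D)^{-k} f((A τ + B) (C τ + D)⁻¹)`.
For symplectic similitudes with totally positive multiplier (the only matrices to which it
is applied) the transformed point again lies in the half-space, so that the default value `0`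
plays no role, and the base of the real power is positive. -/
def slash {K : Type*} [Field K] [NumberField K] {n : ℕ} (k : ℤ)
    (M : Matrix (Fin n ⊕ Fin n) (Fin n ⊕ Fin n) K) (f : HalfSpace K n → ℂ) :
    HalfSpace K n → ℂ := fun τ =>
  (((∏ σ : K →+* ℝ,
        σ (M.toBlocks₁₁ * M.toBlocks₂₂.transpose
            - M.toBlocks₁₂ * M.toBlocks₂₁.transpose).det) ^ ((k : ℝ) / 2) : ℝ) : ℂ) *
    (∏ σ : K →+* ℝ,
        (conjMatrix σ M.toBlocks₂₁ * (τ σ).1 + conjMatrix σ M.toBlocks₂₂).det) ^ (-k) *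
    (if h : ∀ σ, (moebius M τ σ).IsSymm ∧ ((moebius M τ σ).map Complex.im).PosDef then
      f fun σ => ⟨moebius M τ σ, h σ⟩ else 0)

end UpperHalfSpace

section ModularForms

variable {K : Type*} [Field K] [NumberField K] {n : ℕ}

/-- The group `Γ(I₁, …, Iₙ; J)`. -/
def Gam (I : Fin n → FracIdeal K) (J : FracIdeal K) :
    Set (Matrix (Fin n ⊕ Fin n) (Fin n ⊕ Fin n) K) :=
  {M | IsUnit M ∧
    (M.toBlocks₁₁ * M.toBlocks₁₂.transpose).IsSymm ∧
    (M.toBlocks₂₁ * M.toBlocks₂₂.transpose).IsSymm ∧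
    (∃ u : (𝓞 K)ˣ, TotPos ((u : 𝓞 K) : K) ∧
      M.toBlocks₁₁ * M.toBlocks₂₂.transpose - M.toBlocks₁₂ * M.toBlocks₂₁.transpose
        = ((u : 𝓞 K) : K) • (1 : Matrix (Fin n) (Fin n) K)) ∧
    ∀ i j : Fin n,
      M.toBlocks₁₁ i j ∈ ((I i * (I j)⁻¹ : FracIdeal K) : FractionalIdeal (𝓞 K)⁰ K) ∧
      M.toBlocks₁₂ i j ∈ ((I i * I j * J : FracIdeal K) : FractionalIdeal (𝓞 K)⁰ K) *
        ((differentIdeal ℤ (𝓞 K) : Ideal (𝓞 K)) : FractionalIdeal (𝓞 K)⁰ K)⁻¹ ∧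
      M.toBlocks₂₁ i j ∈ (((I i * I j * J)⁻¹ : FracIdeal K) : FractionalIdeal (𝓞 K)⁰ K) *
        ((differentIdeal ℤ (𝓞 K) : Ideal (𝓞 K)) : FractionalIdeal (𝓞 K)⁰ K) ∧
      M.toBlocks₂₂ i j ∈ (((I i)⁻¹ * I j : FracIdeal K) : FractionalIdeal (𝓞 K)⁰ K)}

/-- Symmetric matrices over `K` all of whose real conjugates are positive semi-definite. -/
def IsPosSemidef (T : Matrix (Fin n) (Fin n) K) : Prop :=
  T.IsSymm ∧ ∀ σ : K →+* ℝ, (T.map σ).PosSemidef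

/-- `e{T τ} = exp(π i σ(Tr(T τ)))`, with `Tr(T τ) = ∑_σ T^{(σ)} τ_σ` and `σ` the matrix trace. -/
def expT (T : Matrix (Fin n) (Fin n) K) (τ : HalfSpace K n) : ℂ :=
  Complex.exp (Real.pi * Complex.I * (∑ σ : K →+* ℝ, conjMatrix σ T * (τ σ).1).trace)

/-- `f(τ) = ∑_T a(T) e{T τ}` for all `τ`, where `T` runs over the symmetric positive
semi-definite matrices: `a` is the family of Fourier coefficients `c_f` of `f`. -/
def IsFourierExpansion (f : HalfSpace K n → ℂ) (a : Matrix (Fin n) (Fin n) K → ℂ) : Prop :=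
  (∀ T, ¬ IsPosSemidef T → a T = 0) ∧
  ∀ τ, HasSum (fun T : Matrix (Fin n) (Fin n) K => a T * expT T τ) (f τ)

/-- `f` is a Hilbert-Siegel modular form of weight `k` for `Γ(I₁, …, Iₙ; J)`. -/
structure IsModularForm (k : ℤ) (I : Fin n → FracIdeal K) (J : FracIdeal K)
    (f : HalfSpace K n → ℂ) : Prop where
  expansion : ∃ a, IsFourierExpansion f a
  slash_eq : ∀ M ∈ Gam I J, slash k M f = f

end ModularForms

section Identifications

variable {K : Type*} [Field K] [NumberField K] {n : ℕ}

/-- The block matrix `diag(M, ᵗM⁻¹)`. -/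
def diagBlock (M : Matrix (Fin n) (Fin n) K) : Matrix (Fin n ⊕ Fin n) (Fin n ⊕ Fin n) K :=
  Matrix.fromBlocks M 0 0 M⁻¹.transpose

/-- The identity matrix with the `2 × 2` matrix `A` put in the rows and columns `l, m`. -/
def embedTwo (l m : Fin n) (A : Matrix (Fin 2) (Fin 2) K) : Matrix (Fin n) (Fin n) K :=
  Matrix.of fun i j =>
    if i = l ∧ j = l then A 0 0
    else if i = l ∧ j = m then A 0 1
    else if i = m ∧ j = l then A 1 0
    else if i = m ∧ j = m then A 1 1
    else if i = j then 1 else 0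

/-- A function on the half-space, labelled by a tuple `(I₁, …, Iₙ; J)`: think of an element of
`M_k(Γ(I₁, …, Iₙ; J))`. -/
structure LabelledForm (K : Type*) [Field K] [NumberField K] (n : ℕ) where
  I : Fin n → FracIdeal K
  J : FracIdeal K
  f : HalfSpace K n → ℂ

/-- One application of one of the isomorphisms `U_l(α)`, `W(α)`, `V_l(Q)`. -/
inductive Step (k : ℤ) : LabelledForm K n → LabelledForm K n → Prop
  | U (I : Fin n → FracIdeal K) (J : FracIdeal K) (f : HalfSpace K n → ℂ)
      (l : Fin n) (α : Kˣ) :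
      Step k ⟨I, J, f⟩
        ⟨Function.update I l (toPrincipalIdeal (𝓞 K) K α * I l), J,
          slash k (diagBlock (Matrix.diagonal (Function.update 1 l (α : K)⁻¹))) f⟩
  | W (I : Fin n → FracIdeal K) (J : FracIdeal K) (f : HalfSpace K n → ℂ)
      (α : Kˣ) (hα : TotPos (α : K)) :
      Step k ⟨I, J, f⟩
        ⟨I, toPrincipalIdeal (𝓞 K) K α * J,
          slash k (Matrix.fromBlocks ((α : K)⁻¹ • (1 : Matrix (Fin n) (Fin n) K)) 0 0 1) f⟩
  | V (I : Fin n → FracIdeal K) (J : FracIdeal K) (f : HalfSpace K n → ℂ)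
      (l m : Fin n) (hlm : (m : ℕ) = l + 1) (Q : FracIdeal K)
      (A : Matrix (Fin 2) (Fin 2) K) (hA : A.det = 1)
      (h00 : A 0 0 ∈ ((Q⁻¹ : FracIdeal K) : FractionalIdeal (𝓞 K)⁰ K))
      (h01 : A 0 1 ∈ ((Q * I l * (I m)⁻¹ : FracIdeal K) : FractionalIdeal (𝓞 K)⁰ K))
      (h10 : A 1 0 ∈ ((Q⁻¹ * (I l)⁻¹ * I m : FracIdeal K) : FractionalIdeal (𝓞 K)⁰ K))
      (h11 : A 1 1 ∈ (Q : FractionalIdeal (𝓞 K)⁰ K)) :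
      Step k ⟨I, J, f⟩
        ⟨Function.update (Function.update I l (Q * I l)) m (Q⁻¹ * I m), J,
          slash k (diagBlock (embedTwo l m A)) f⟩

/-- The relation `∼`: some composition of the isomorphisms takes the first form to the second. -/
def Equivalent (k : ℤ) : LabelledForm K n → LabelledForm K n → Prop :=
  Relation.ReflTransGen (Step k)

variable (K n) in
/-- A family with one modular form for every tuple `(I₁, …, Iₙ; J)`, in which forms in
naturally isomorphic spaces are equivalent: it represents an element of
`∏ M_k(Γ(I₁, …, Iₙ; J)) / ∼`. -/
structure Family (k : ℤ) where
  comp : (Fin n → FracIdeal K) → FracIdeal K → HalfSpace K n → ℂ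
  isModularForm : ∀ I J, IsModularForm k I J (comp I J)
  equivalent : ∀ I J I' J',
    (∃ g, Equivalent k ⟨I, J, comp I J⟩ ⟨I', J', g⟩) →
      Equivalent k ⟨I, J, comp I J⟩ ⟨I', J', comp I' J'⟩

variable (K n) in
/-- (Families representing) elements of `M_k`: moreover tuples that are two names of one and
the same group, such as `(I₁, …, Iₙ; Q² J)` and `(Q I₁, …, Q Iₙ; J)`, carry the same form. -/
structure Mk (k : ℤ) extends Family K n k where
  comp_eq : ∀ I J I' J', Gam I J = Gam I' J' → comp I J = comp I' J'

end Identifications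

section Lattices

variable {K : Type*} [Field K] [NumberField K] {n : ℕ}
variable {V : Type*} [AddCommGroup V] [Module K V]

variable (K n V) in
/-- Two bases have the same orientation if the change of basis has totally positive
determinant. -/
def orientationSetoid : Setoid (Module.Basis (Fin n) K V) where
  r x y := TotPos (x.toMatrix y).det
  iseqv :=
    { refl := fun x σ => by simp
      symm := fun {x y} h σ => by
        have h1 : (x.toMatrix y).det * (y.toMatrix x).det = 1 := by
          rw [← Matrix.det_mul, Module.Basis.toMatrix_mul_toMatrix_flip, Matrix.det_one]
        have h2 : σ (x.toMatrix y).det * σ (y.toMatrix x).det = 1 := by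
          rw [← map_mul, h1, map_one]
        exact pos_of_mul_pos_right (h2 ▸ one_pos) (h σ).le
      trans := fun {x y z} h h' σ => by
        have h1 : (x.toMatrix y).det * (y.toMatrix z).det = (x.toMatrix z).det := by
          rw [← Matrix.det_mul, Module.Basis.toMatrix_mul_toMatrix]
        have h2 := mul_pos (h σ) (h' σ)
        rwa [← map_mul, h1] at h2 }

variable (K n V) in
/-- An orientation of `V`, and of the lattices on `V`. -/
def VOrientation : Type _ := Quotient (orientationSetoid K n V)

variable [Module (𝓞 K) V]

/-- `Λ = I₁ x₁ ⊕ ⋯ ⊕ Iₙ xₙ`. -/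
def IsDecomposition (Λ : Submodule (𝓞 K) V) (x : Module.Basis (Fin n) K V)
    (I : Fin n → FracIdeal K) : Prop :=
  ∀ v : V, v ∈ Λ ↔ ∀ i, x.repr v i ∈ (I i : FractionalIdeal (𝓞 K)⁰ K)

/-- `Λ^J` is even integral for the quadratic form `Q(v) = B(v, v)`: `Q(Λ) ⊆ 2 J⁻¹`. -/
def IsEvenIntegral (B : LinearMap.BilinForm K V) (Λ : Submodule (𝓞 K) V) (J : FracIdeal K) :
    Prop :=
  ∀ v ∈ Λ, ∃ b ∈ ((J⁻¹ : FracIdeal K) : FractionalIdeal (𝓞 K)⁰ K), B v v = 2 * b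

/-- `z` is a value of the Fourier coefficient `c(Λ^J) = c_f(T) N(I₁⋯Iₙ)^k N(J)^{nk/2}` of `F`,
computed from some decomposition `Λ = I₁ x₁ ⊕ ⋯ ⊕ Iₙ xₙ` (with `x` in the given orientation if
`k` is odd), some representative `f ∈ M_k(Γ(I₁, …, Iₙ; J))` of the component of `F`, and
`T = (B(xᵢ, xⱼ))`. -/
def IsFourierCoeff {k : ℤ} (F : Family K n k) (B : LinearMap.BilinForm K V)
    (Λ : Submodule (𝓞 K) V) (ω : Odd k → VOrientation K n V) (J : FracIdeal K) (z : ℂ) : Prop :=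
  ∃ (x : Module.Basis (Fin n) K V) (I : Fin n → FracIdeal K)
    (f : HalfSpace K n → ℂ) (a : Matrix (Fin n) (Fin n) K → ℂ),
    (∀ hk : Odd k, Quotient.mk (orientationSetoid K n V) x = ω hk) ∧
    IsDecomposition Λ x I ∧
    IsModularForm k I J f ∧
    Equivalent k ⟨I, J, F.comp I J⟩ ⟨I, J, f⟩ ∧
    IsFourierExpansion f a ∧
    z = a (Matrix.of fun i j => B (x i) (x j)) *
      ((FractionalIdeal.absNorm ((∏ i, I i : FracIdeal K) : FractionalIdeal (𝓞 K)⁰ K) : ℚ) : ℂ)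
        ^ k *
      ((((FractionalIdeal.absNorm (J : FractionalIdeal (𝓞 K)⁰ K) : ℚ) : ℝ)
        ^ ((n : ℝ) * (k : ℝ) / 2) : ℝ) : ℂ)

end Lattices

end HilbertSiegel

end

/-!
Each of the maps `U_l`, `W`, `V_l` is the weight `k` operator of a similitude `diag(β⁻¹ M, ᵗM⁻¹)`,
that is, `f'(τ) = N(β)^{-nk/2} N(det M)^k f(β⁻¹ M τ ᵗM)`, where `β` takes `J` to `J'` and `M` maps
`⨁ I'ᵢ` isomorphically onto `⨁ Iᵢ`. This property is closed under composition and inversion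
(`IsTransport`), so it holds for any path of maps. On Fourier coefficients the operator reads
`c_{f'}(β⁻¹ ᵗM T M) = N(β)^{-nk/2} N(det M)^k c_f(T)`.

Let `Λ = ⨁ Iᵢ xᵢ = ⨁ I'ᵢ x'ᵢ` with `x' = x M`, and let `f`, `f'` be representatives at
`(I₁, …, Iₙ; J)` and `(I'₁, …, I'ₙ; δJ)`. Comparing determinants, `∏ Iᵢ = (det M) ∏ I'ᵢ`, so the two
tuples are connected by maps (`exists_equivalent`), hence `f` and `f'` are connected by a path, with a
matrix `M₀` and a multiplier `β`. Neither needs to be `M` or `δ`, but the quotient of the two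
similitudes lies in `Γ(I'₁, …, I'ₙ; δJ)`, under which `f'` is invariant; so the formula above also
holds for `M` and `δ` (`IsTransport.change`). There `δ⁻¹ ᵗM T M` is the matrix of the form `δ⁻¹ B` in
the basis `x'`, and the factor is the quotient of the norm factors in the definition of `c(Λ^J)`,
because `N(det M)^k = |N(det M)|^k`: for odd `k` both bases have the given orientation. This is
`IsFourierCoeff.eq`, which for `δ = 1` is the uniqueness of the value and for general `δ` its
invariance under scaling.

It remains to see that Fourier expansions are unique (`IsFourierExpansion.unique`: translate in
a real direction in which distinct symmetric matrices over `K` give distinct characters, and take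
means), that decompositions exist (`exists_isDecomposition_of_fg`), and that
`(Q⁻¹ I₁, …, Q⁻¹ Iₙ; Q² J)` defines the same group as `(I₁, …, Iₙ; J)`, with equal norm factors.
-/

noncomputable section

namespace HilbertSiegel

/-! ### The half-space and block diagonal similitudes -/

section

variable {K : Type*} [Field K] {n : ℕ}

lemma TotPos.mul {a b : K} (ha : TotPos a) (hb : TotPos b) : TotPos (a * b) := fun σ => by
  rw [map_mul]; exact mul_pos (ha σ) (hb σ)

lemma TotPos.inv {a : K} (ha : TotPos a) : TotPos a⁻¹ := fun σ => by
  rw [map_inv₀]; exact inv_pos.2 (ha σ)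

lemma totPos_one : TotPos (1 : K) := fun σ => by simp

section

variable {m l p : Type*} (σ : K →+* ℝ)

lemma conjMatrix_eq_map (M : Matrix m l K) :
    conjMatrix σ M = M.map (Complex.ofRealHom.comp σ) := rfl

lemma conjMatrix_mul [Fintype l] (M : Matrix m l K) (N : Matrix l p K) :
    conjMatrix σ (M * N) = conjMatrix σ M * conjMatrix σ N := by
  simp only [conjMatrix_eq_map, Matrix.map_mul]

@[simp] lemma conjMatrix_one [DecidableEq m] : conjMatrix σ (1 : Matrix m m K) = 1 := by
  rw [conjMatrix_eq_map, Matrix.map_one _ (map_zero _) (map_one _)]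

@[simp] lemma conjMatrix_zero : conjMatrix σ (0 : Matrix m l K) = 0 := by
  rw [conjMatrix_eq_map, Matrix.map_zero _ (map_zero _)]

lemma conjMatrix_smul (c : K) (M : Matrix m l K) :
    conjMatrix σ (c • M) = ((σ c : ℝ) : ℂ) • conjMatrix σ M := by
  ext i j; simp [conjMatrix]

lemma conjMatrix_transpose (M : Matrix m l K) :
    conjMatrix σ M.transpose = (conjMatrix σ M).transpose := rfl

lemma det_conjMatrix [Fintype m] [DecidableEq m] (M : Matrix m m K) :
    (conjMatrix σ M).det = ((σ M.det : ℝ) : ℂ) := by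
  rw [conjMatrix_eq_map]
  exact ((Complex.ofRealHom.comp σ).map_det M).symm

lemma conjMatrix_inv [Fintype m] [DecidableEq m] (M : GL m K) :
    (conjMatrix σ (M : Matrix m m K))⁻¹ = conjMatrix σ (M⁻¹ : GL m K) := by
  apply Matrix.inv_eq_right_inv
  rw [← conjMatrix_mul, ← Units.val_mul, mul_inv_cancel, Units.val_one, conjMatrix_one]

end

/-- The point `β⁻¹ M τ ᵗM` of the product of half-spaces, for `β ≫ 0`: the image of `τ` under the
symplectic similitude `diag(β⁻¹ M, ᵗM⁻¹)`. -/
def levi (β : Kˣ) (hβ : TotPos (β : K)) (M : GL (Fin n) K) (τ : HalfSpace K n) :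
    HalfSpace K n := fun σ =>
  ⟨conjMatrix σ ((β : K)⁻¹ • M.1) * (τ σ).1 * (conjMatrix σ M.1).transpose, by
    rw [Matrix.IsSymm, Matrix.transpose_mul, Matrix.transpose_mul, (τ σ).2.1.eq, conjMatrix_smul,
      Matrix.transpose_smul, Matrix.transpose_transpose]
    simp [Matrix.mul_assoc], by
    have h : (conjMatrix σ ((β : K)⁻¹ • M.1) * (τ σ).1 * (conjMatrix σ M.1).transpose).map
        Complex.im = (σ (β : K))⁻¹ •
          (M.1.map σ * ((τ σ).1.map Complex.im) * (M.1.map σ).conjTranspose) := by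
      ext i j
      simp [conjMatrix, Matrix.mul_apply, Complex.im_sum, Finset.mul_sum, Finset.sum_mul]
      refine Finset.sum_congr rfl fun a _ => Finset.sum_congr rfl fun b _ => ?_
      ring
    rw [h]
    refine Matrix.PosDef.smul ((τ σ).2.2.mul_mul_conjTranspose_same ?_) (inv_pos.2 (hβ σ))
    have hu : IsUnit (M.1.map σ) := (M.isUnit.map σ.mapMatrix)
    exact Matrix.vecMul_injective_of_isUnit hu⟩

lemma levi_levi {β γ : Kˣ} (hβ : TotPos (β : K)) (hγ : TotPos (γ : K)) (M N : GL (Fin n) K)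
    (τ : HalfSpace K n) :
    levi β hβ M (levi γ hγ N τ) = levi (β * γ) (by rw [Units.val_mul]; exact hβ.mul hγ)
      (M * N) τ := by
  funext σ
  apply Subtype.ext
  simp only [levi, conjMatrix_smul, Units.val_mul, conjMatrix_mul, Matrix.transpose_mul,
    mul_inv, map_mul, Complex.ofReal_mul, Matrix.smul_mul, Matrix.mul_smul, smul_smul,
    Matrix.mul_assoc]
  rw [mul_comm (((σ (γ : K)⁻¹ : ℝ) : ℂ))]

lemma levi_one (h : TotPos ((1 : Kˣ) : K)) (τ : HalfSpace K n) : levi 1 h 1 τ = τ := by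
  funext σ
  apply Subtype.ext
  simp [levi]

end

variable {K : Type*} [Field K] [NumberField K] {n : ℕ}

/-! ### The norm of a totally real field -/

variable (K) in
/-- The norm of a totally real field, as the product of all real conjugates. -/
def realNorm : K →* ℝ := ∏ σ : K →+* ℝ, (σ : K →* ℝ)

lemma realNorm_apply (x : K) : realNorm K x = ∏ σ : K →+* ℝ, σ x := by
  simp [realNorm]

lemma realNorm_pos {x : K} (hx : TotPos x) : 0 < realNorm K x := by
  rw [realNorm_apply]
  exact Finset.prod_pos fun σ _ => hx σ

lemma realNorm_inv (x : K) : realNorm K x⁻¹ = (realNorm K x)⁻¹ := by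
  simp [realNorm_apply]

lemma realNorm_eq_norm [IsTotallyReal K] (x : K) :
    realNorm K x = ((Algebra.norm ℚ x : ℚ) : ℝ) := by
  have h := Algebra.norm_eq_prod_embeddings ℚ ℂ x
  have hreal : ∀ φ : K →+* ℂ, ComplexEmbedding.IsReal φ := fun φ =>
    InfinitePlace.isReal_mk_iff.1 (IsTotallyReal.isReal (InfinitePlace.mk φ))
  let e : (K →+* ℝ) ≃ (K →ₐ[ℚ] ℂ) :=
    { toFun := fun σ => (Complex.ofRealHom.comp σ).toRatAlgHom
      invFun := fun φ => (hreal φ.toRingHom).embedding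
      left_inv := fun σ => by
        ext x
        apply Complex.ofReal_injective
        rw [ComplexEmbedding.IsReal.coe_embedding_apply]
        rfl
      right_inv := fun φ => by
        ext x
        exact ComplexEmbedding.IsReal.coe_embedding_apply (hreal φ.toRingHom) x }
  rw [← Equiv.prod_comp e] at h
  apply Complex.ofReal_injective
  rw [realNorm_apply, Complex.ofReal_prod]
  rw [eq_ratCast] at h
  rw [Complex.ofReal_ratCast, h]
  rfl

lemma abs_realNorm [IsTotallyReal K] (x : Kˣ) :
    |realNorm K x| = ((FractionalIdeal.absNorm
      (toPrincipalIdeal (𝓞 K) K x : FractionalIdeal (𝓞 K)⁰ K) : ℚ) : ℝ) := by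
  rw [coe_toPrincipalIdeal, FractionalIdeal.absNorm_span_singleton, realNorm_eq_norm, Rat.cast_abs]

/-! ### The weight `k` operator of block diagonal similitudes -/

/-- The factor `N(β)^{-nk/2} N(det M)^k` of the weight `k` operator of `diag(β⁻¹ M, ᵗM⁻¹)`. -/
def leviFactor (k : ℤ) (β : Kˣ) (M : GL (Fin n) K) : ℝ :=
  realNorm K β ^ (-((n : ℝ) * k / 2)) * realNorm K M.1.det ^ k

lemma leviFactor_mul (k : ℤ) {β γ : Kˣ} (hβ : TotPos (β : K)) (hγ : TotPos (γ : K))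
    (M N : GL (Fin n) K) :
    leviFactor k (β * γ) (M * N) = leviFactor k β M * leviFactor k γ N := by
  rw [leviFactor, Units.val_mul, Units.val_mul, Matrix.det_mul, map_mul, map_mul,
    Real.mul_rpow (realNorm_pos hβ).le (realNorm_pos hγ).le, mul_zpow]
  simp only [leviFactor]
  ring

lemma leviFactor_one (k : ℤ) : leviFactor k (1 : Kˣ) (1 : GL (Fin n) K) = 1 := by
  simp [leviFactor]

/-- `f'` is the image of `f` under the weight `k` operator of `diag(β⁻¹ M, ᵗM⁻¹)`. -/
def IsLeviSlash (k : ℤ) (β : Kˣ) (M : GL (Fin n) K) (f f' : HalfSpace K n → ℂ) : Prop :=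
  ∃ hβ : TotPos (β : K), ∀ τ, f' τ = (leviFactor k β M : ℂ) * f (levi β hβ M τ)

lemma IsLeviSlash.refl (k : ℤ) (f : HalfSpace K n → ℂ) : IsLeviSlash k 1 1 f f :=
  ⟨by simpa using totPos_one, fun τ => by simp [leviFactor_one, levi_one]⟩

lemma IsLeviSlash.trans {k : ℤ} {β γ : Kˣ} {M N : GL (Fin n) K} {f g h : HalfSpace K n → ℂ}
    (h₁ : IsLeviSlash k β M f g) (h₂ : IsLeviSlash k γ N g h) :
    IsLeviSlash k (β * γ) (M * N) f h := by
  obtain ⟨hβ, h₁⟩ := h₁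
  obtain ⟨hγ, h₂⟩ := h₂
  refine ⟨by rw [Units.val_mul]; exact hβ.mul hγ, fun τ => ?_⟩
  rw [h₂, h₁, levi_levi, leviFactor_mul k hβ hγ]
  push_cast
  ring

lemma IsLeviSlash.symm {k : ℤ} {β : Kˣ} {M : GL (Fin n) K} {f g : HalfSpace K n → ℂ}
    (h : IsLeviSlash k β M f g) : IsLeviSlash k β⁻¹ M⁻¹ g f := by
  obtain ⟨hβ, h⟩ := h
  have hβ' : TotPos ((β⁻¹ : Kˣ) : K) := by rw [Units.val_inv_eq_inv_val]; exact hβ.inv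
  refine ⟨hβ', fun τ => ?_⟩
  have hc := leviFactor_mul k hβ hβ' M M⁻¹
  rw [mul_inv_cancel, mul_inv_cancel, leviFactor_one] at hc
  rw [h, levi_levi, ← mul_assoc, ← Complex.ofReal_mul, mul_comm (leviFactor k β⁻¹ M⁻¹), ← hc]
  have hlevi : ∀ (γ : Kˣ) (N : GL (Fin n) K) (hγ : TotPos (γ : K)), γ = 1 → N = 1 →
      levi γ hγ N τ = τ := by
    rintro _ _ hγ rfl rfl
    exact levi_one hγ τ
  rw [hlevi _ _ _ (mul_inv_cancel β) (mul_inv_cancel M)]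
  simp

/-- For `diag(β⁻¹ M, ᵗM⁻¹)` the default value in `slash` does not occur, and the factors in front of
`f` combine to `leviFactor`. -/
lemma isLeviSlash_slash (k : ℤ) {β : Kˣ} (hβ : TotPos (β : K)) (M : GL (Fin n) K)
    (f : HalfSpace K n → ℂ) :
    IsLeviSlash k β M f
      (slash k (Matrix.fromBlocks ((β : K)⁻¹ • M.1) 0 0 (M.1)⁻¹.transpose) f) := by
  refine ⟨hβ, fun τ => ?_⟩
  have hM : M.1 * M.1⁻¹ = 1 := by
    rw [← Matrix.coe_units_inv, ← Units.val_mul, mul_inv_cancel, Units.val_one]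
  have hmoeb : ∀ σ, moebius (Matrix.fromBlocks ((β : K)⁻¹ • M.1) 0 0 (M.1)⁻¹.transpose) τ σ
      = (levi β hβ M τ σ).1 := fun σ => by
    have h2 : (conjMatrix σ M.1⁻¹)⁻¹ = conjMatrix σ M.1 := by
      rw [← Matrix.coe_units_inv, conjMatrix_inv, inv_inv]
    simp only [moebius, levi, Matrix.toBlocks_fromBlocks₁₁, Matrix.toBlocks_fromBlocks₁₂,
      Matrix.toBlocks_fromBlocks₂₁, Matrix.toBlocks_fromBlocks₂₂, conjMatrix_zero, add_zero,
      zero_mul, zero_add, conjMatrix_transpose]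
    rw [← Matrix.transpose_nonsing_inv, h2]
  have hall : ∀ σ, (moebius (Matrix.fromBlocks ((β : K)⁻¹ • M.1) 0 0 (M.1)⁻¹.transpose) τ
      σ).IsSymm ∧ ((moebius (Matrix.fromBlocks ((β : K)⁻¹ • M.1) 0 0 (M.1)⁻¹.transpose) τ
      σ).map Complex.im).PosDef := fun σ => by
    rw [hmoeb]; exact (levi β hβ M τ σ).2
  have hpt : (fun σ => ⟨_, hall σ⟩ : HalfSpace K n) = levi β hβ M τ :=
    funext fun σ => Subtype.ext (hmoeb σ)
  rw [slash, dif_pos hall, hpt]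
  congr 1
  simp only [Matrix.toBlocks_fromBlocks₁₁, Matrix.toBlocks_fromBlocks₁₂,
      Matrix.toBlocks_fromBlocks₂₁, Matrix.toBlocks_fromBlocks₂₂, conjMatrix_zero,
      zero_mul, zero_add, Matrix.transpose_transpose, sub_zero, Matrix.smul_mul, hM,
      Matrix.det_smul, Matrix.det_one, mul_one, Fintype.card_fin, det_conjMatrix,
      Matrix.det_transpose]
  rw [← realNorm_apply, ← Complex.ofReal_prod, ← realNorm_apply, leviFactor,
    Matrix.det_nonsing_inv, Ring.inverse_eq_inv', realNorm_inv, map_pow, realNorm_inv,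
    ← Real.rpow_natCast, ← Real.rpow_mul (inv_pos.2 (realNorm_pos hβ)).le,
    Real.inv_rpow (realNorm_pos hβ).le, ← Real.rpow_neg (realNorm_pos hβ).le]
  push_cast
  rw [inv_zpow', neg_neg, mul_div_assoc]

/-! ### Uniqueness of Fourier coefficients -/

open Filter Topology

/-- The Cesàro means of the powers of a complex number `w ≠ 1` of modulus one tend to `0`. -/
lemma tendsto_cesaro_pow_zero {w : ℂ} (hw : ‖w‖ = 1) (hw1 : w ≠ 1) :
    Tendsto (fun N : ℕ => (N : ℂ)⁻¹ * ∑ s ∈ Finset.range N, w ^ s) atTop (𝓝 0) := by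
  have hlim : Tendsto (fun N : ℕ => 2 / ‖w - 1‖ * (N : ℝ)⁻¹) atTop (𝓝 0) := by
    simpa using (tendsto_inv_atTop_nhds_zero_nat (𝕜 := ℝ)).const_mul (2 / ‖w - 1‖)
  refine squeeze_zero_norm (fun N => ?_) hlim
  rw [geom_sum_eq hw1, norm_mul, norm_inv, Complex.norm_natCast, norm_div, mul_comm]
  gcongr
  calc ‖w ^ N - 1‖ ≤ ‖w ^ N‖ + ‖(1 : ℂ)‖ := norm_sub_le _ _
    _ = 2 := by rw [norm_pow, hw]; norm_num

lemma norm_cesaro_pow_le {w : ℂ} (hw : ‖w‖ = 1) (N : ℕ) :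
    ‖(N : ℂ)⁻¹ * ∑ s ∈ Finset.range N, w ^ s‖ ≤ 1 := by
  rw [norm_mul, norm_inv, Complex.norm_natCast]
  have h : ‖∑ s ∈ Finset.range N, w ^ s‖ ≤ N := by
    refine (norm_sum_le _ _).trans ?_
    simp [hw]
  exact (mul_le_mul_of_nonneg_left h (by positivity)).trans (inv_mul_le_one)

/-- An absolutely convergent sum of powers of numbers of modulus one that vanishes at all exponents
`s : ℕ` has coefficient zero at any index whose base is different from all others: twist this base
to `1` and take the mean over `s`. -/
lemma eq_zero_of_forall_hasSum_pow {ι : Type*} {b w : ι → ℂ} (hb : Summable b)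
    (hw : ∀ i, ‖w i‖ = 1) (hsum : ∀ s : ℕ, HasSum (fun i => b i * w i ^ s) 0)
    (i₀ : ι) (hne : ∀ i, b i ≠ 0 → i ≠ i₀ → w i ≠ w i₀) : b i₀ = 0 := by
  classical
  set v : ι → ℂ := fun i => w i * (w i₀)⁻¹ with hv
  have hw0 : w i₀ ≠ 0 := fun h => by simpa [h] using hw i₀
  have hvn : ∀ i, ‖v i‖ = 1 := fun i => by simp [hv, hw]
  have hsum' : ∀ N : ℕ, HasSum (fun i => b i * ((N : ℂ)⁻¹ * ∑ s ∈ Finset.range N, v i ^ s)) 0 := by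
    intro N
    have h1 : HasSum (fun i => ∑ s ∈ Finset.range N, (N : ℂ)⁻¹ * ((w i₀)⁻¹ ^ s *
        (b i * w i ^ s))) (∑ s ∈ Finset.range N, (N : ℂ)⁻¹ * ((w i₀)⁻¹ ^ s * 0)) :=
      hasSum_sum fun s _ => ((hsum s).mul_left _).mul_left _
    simp only [mul_zero, Finset.sum_const_zero] at h1
    refine h1.congr_fun fun i => ?_
    simp only [Finset.mul_sum, hv, mul_pow]
    refine Finset.sum_congr rfl fun s _ => by ring
  have hlim : Tendsto (fun N : ℕ => ∑' i, b i * ((N : ℂ)⁻¹ * ∑ s ∈ Finset.range N, v i ^ s)) atTop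
      (𝓝 (∑' i, if i = i₀ then b i₀ else 0)) := by
    refine tendsto_tsum_of_dominated_convergence hb.norm (fun i => ?_)
      (Eventually.of_forall fun N i => ?_)
    · split_ifs with h
      · subst h
        have hv1 : v i = 1 := mul_inv_cancel₀ hw0
        refine tendsto_const_nhds.congr' ?_
        filter_upwards [eventually_gt_atTop 0] with N hN
        have : (N : ℂ) ≠ 0 := by exact_mod_cast hN.ne'
        simp [hv1, this]
      · by_cases hbi : b i = 0
        · simp [hbi]
        · have hv1 : v i ≠ 1 := fun h1 => hne i hbi h ((mul_inv_eq_one₀ hw0).1 h1)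
          simpa using (tendsto_cesaro_pow_zero (hvn i) hv1).const_mul (b i)
    · rw [norm_mul]
      exact mul_le_of_le_one_right (norm_nonneg _) (norm_cesaro_pow_le (hvn i) N)
  simp only [fun N => (hsum' N).tsum_eq, tsum_ite_eq] at hlim
  exact (tendsto_nhds_unique hlim tendsto_const_nhds)

/-- Number fields are countable, so almost all real numbers are transcendental over them. -/
lemma exists_transcendental_real [Algebra K ℝ] : ∃ t : ℝ, Transcendental K t := by
  have : Countable K := (Module.finBasis ℚ K).equivFun.injective.countable
  by_contra! h
  have h2 : {t : ℝ | IsAlgebraic K t} = Set.univ := Set.eq_univ_of_forall fun t => by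
    by_contra ht
    exact h t ht
  have := Algebraic.countable K ℝ
  rw [h2] at this
  exact Cardinal.not_countable_real this

/-- The symmetric matrix with entries `t^{e(i,j)} + t^{e(j,i)}`, all exponents `e(i,j) > 0` being
distinct. -/
def directionMatrix (n : ℕ) (t : ℝ) : Matrix (Fin n) (Fin n) ℝ :=
  Matrix.of fun i j =>
    t ^ ((finProdFinEquiv (i, j) : ℕ) + 1) + t ^ ((finProdFinEquiv (j, i) : ℕ) + 1)

/-- If `t` is transcendental over `K`, the trace form with `directionMatrix n t` takes integral
values at no nonzero symmetric matrix over `K`. -/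
lemma eq_zero_of_trace_directionMatrix [Algebra K ℝ] {t : ℝ} (ht : Transcendental K t)
    {T : Matrix (Fin n) (Fin n) K} (hT : T.IsSymm) (m : ℤ)
    (h : (T.map (algebraMap K ℝ) * directionMatrix n t).trace = m) : T = 0 := by
  let p : Polynomial K := ∑ q : Fin n × Fin n,
    Polynomial.monomial ((finProdFinEquiv q : ℕ) + 1) (2 * T q.1 q.2) - Polynomial.C (m : K)
  have hp : Polynomial.aeval t p = 0 := by
    have htr : (T.map (algebraMap K ℝ) * directionMatrix n t).trace =
        ∑ q : Fin n × Fin n, algebraMap K ℝ (2 * T q.1 q.2) * t ^ ((finProdFinEquiv q : ℕ) + 1) := by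
      have h1 : (T.map (algebraMap K ℝ) * directionMatrix n t).trace =
          ∑ i, ∑ j, algebraMap K ℝ (T i j) * t ^ ((finProdFinEquiv (i, j) : ℕ) + 1) +
          ∑ i, ∑ j, algebraMap K ℝ (T i j) * t ^ ((finProdFinEquiv (j, i) : ℕ) + 1) := by
        simp only [Matrix.trace, Matrix.diag, Matrix.mul_apply, directionMatrix, Matrix.of_apply,
          Matrix.map_apply, mul_add, Finset.sum_add_distrib]
        rw [add_comm]
      have h2 : ∑ i, ∑ j, algebraMap K ℝ (T i j) * t ^ ((finProdFinEquiv (j, i) : ℕ) + 1) =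
          ∑ i, ∑ j, algebraMap K ℝ (T i j) * t ^ ((finProdFinEquiv (i, j) : ℕ) + 1) := by
        rw [Finset.sum_comm]
        simp only [hT.apply]
      rw [h1, h2, Fintype.sum_prod_type, ← two_mul, Finset.mul_sum]
      refine Finset.sum_congr rfl fun i _ => ?_
      rw [Finset.mul_sum]
      refine Finset.sum_congr rfl fun j _ => ?_
      rw [map_mul, map_ofNat]
      ring
    simp only [p, map_sub, map_sum, Polynomial.aeval_monomial, map_intCast]
    rw [← htr, h, sub_self]
  have hp0 : p = 0 := by
    by_contra hne
    exact ht ⟨p, hne, hp⟩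
  ext i j
  have hc : p.coeff ((finProdFinEquiv (i, j) : ℕ) + 1) = 2 * T i j := by
    have hiff : ∀ q : Fin n × Fin n, ((finProdFinEquiv q : ℕ) + 1 =
        (finProdFinEquiv (i, j) : ℕ) + 1) ↔ q = (i, j) := fun q => by
      rw [Nat.add_right_cancel_iff, Fin.val_inj, EmbeddingLike.apply_eq_iff_eq]
    simp only [p, Polynomial.coeff_sub, Polynomial.finsetSum_coeff, Polynomial.coeff_monomial,
      Polynomial.coeff_C_succ, hiff, Finset.sum_ite_eq', Finset.mem_univ, if_true, sub_zero]
  rw [hp0, Polynomial.coeff_zero] at hc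
  simpa using hc.symm

/-- The Fourier coefficients of a function on the half-space are unique. -/
theorem IsFourierExpansion.unique [IsTotallyReal K] {f : HalfSpace K n → ℂ}
    {a a' : Matrix (Fin n) (Fin n) K → ℂ} (h : IsFourierExpansion f a)
    (h' : IsFourierExpansion f a') : a = a' := by
  classical
  obtain ⟨v⟩ := (inferInstance : Nonempty (InfinitePlace K))
  let σ₀ : K →+* ℝ := InfinitePlace.embedding_of_isReal (IsTotallyReal.isReal v)
  let _ : Algebra K ℝ := σ₀.toAlgebra
  obtain ⟨t, ht⟩ := exists_transcendental_real (K := K)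
  let X := directionMatrix n t
  have hX : X.IsSymm := by
    ext i j
    simp [X, directionMatrix, add_comm]
  -- The points `i + s X`, with the translation by `X` in the coordinate `σ₀` only.
  let pt : ℕ → HalfSpace K n := fun s σ =>
    ⟨Complex.I • (1 : Matrix (Fin n) (Fin n) ℂ) +
      (if σ = σ₀ then (s : ℂ) else 0) • X.map Complex.ofReal, by
      rw [Matrix.IsSymm, Matrix.transpose_add, Matrix.transpose_smul, Matrix.transpose_smul,
        Matrix.transpose_one, ← Matrix.transpose_map, hX.eq], by
      have : (Complex.I • (1 : Matrix (Fin n) (Fin n) ℂ) +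
          (if σ = σ₀ then (s : ℂ) else 0) • X.map Complex.ofReal).map Complex.im = 1 := by
        ext i j
        by_cases hij : i = j <;> by_cases hσ : σ = σ₀ <;> simp [hij, hσ, Matrix.one_apply]
      rw [this]
      exact Matrix.PosDef.one⟩
  let r : Matrix (Fin n) (Fin n) K → ℝ := fun T => (T.map σ₀ * X).trace
  have hexp : ∀ T s, expT T (pt s) = expT T (pt 0) *
      Complex.exp (Real.pi * Complex.I * r T) ^ s := by
    intro T s
    have hsum : (∑ σ : K →+* ℝ, conjMatrix σ T * (pt s σ).1).trace =
        (∑ σ : K →+* ℝ, conjMatrix σ T * (pt 0 σ).1).trace + s * r T := by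
      have hr : ((r T : ℝ) : ℂ) = (conjMatrix σ₀ T * X.map Complex.ofReal).trace := by
        simp [r, Matrix.trace, Matrix.mul_apply, conjMatrix]
      have hσ : ∀ σ, conjMatrix σ T * (pt s σ).1 = conjMatrix σ T * (pt 0 σ).1 +
          if σ = σ₀ then (s : ℂ) • (conjMatrix σ₀ T * X.map Complex.ofReal) else 0 := by
        intro σ
        by_cases h : σ = σ₀
        · subst h
          simp [pt, Matrix.mul_add]
        · simp [pt, h]
      rw [Finset.sum_congr rfl fun σ _ => hσ σ, Finset.sum_add_distrib, Matrix.trace_add,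
        Finset.sum_ite_eq', if_pos (Finset.mem_univ _), Matrix.trace_smul, smul_eq_mul, hr]
    rw [expT, expT, hsum, ← Complex.exp_nat_mul, ← Complex.exp_add]
    congr 1
    ring
  have hd : ∀ s, HasSum (fun T => (a T - a' T) * expT T (pt 0) *
      Complex.exp (Real.pi * Complex.I * r T) ^ s) 0 := by
    intro s
    have := (h.2 (pt s)).sub (h'.2 (pt s))
    rw [sub_self] at this
    refine this.congr_fun fun T => ?_
    rw [hexp T s]
    ring
  have hsymm : ∀ T, (a T - a' T) * expT T (pt 0) ≠ 0 → T.IsSymm := by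
    intro T hT
    by_contra hns
    have hn : ¬ IsPosSemidef T := fun hp => hns hp.1
    exact hT (by rw [h.1 T hn, h'.1 T hn]; simp)
  funext T₀
  by_contra hne
  have hb0 : (a T₀ - a' T₀) * expT T₀ (pt 0) ≠ 0 :=
    mul_ne_zero (sub_ne_zero.2 hne) (Complex.exp_ne_zero _)
  refine hb0 (eq_zero_of_forall_hasSum_pow (b := fun T => (a T - a' T) * expT T (pt 0))
    (w := fun T => Complex.exp (Real.pi * Complex.I * r T)) ?_ ?_ hd T₀ ?_)
  · simpa using (hd 0).summable
  · intro T
    rw [show (Real.pi * Complex.I * r T : ℂ) = ((Real.pi * r T : ℝ) : ℂ) * Complex.I by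
      push_cast; ring]
    exact Complex.norm_exp_ofReal_mul_I _
  · intro T hT hTne heq
    obtain ⟨m, hm⟩ := Complex.exp_eq_exp_iff_exists_int.1 heq
    have hπ : (Real.pi * Complex.I : ℂ) ≠ 0 :=
      mul_ne_zero (Complex.ofReal_ne_zero.2 Real.pi_ne_zero) Complex.I_ne_zero
    have hr : r (T - T₀) = ((2 * m : ℤ) : ℝ) := by
      have h1 : (r T : ℂ) = r T₀ + 2 * m := by
        apply mul_left_cancel₀ hπ
        rw [hm]
        ring
      have h2 : r T = r T₀ + 2 * m := by exact_mod_cast h1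
      have h3 : r (T - T₀) = r T - r T₀ := by
        simp only [r]
        rw [← Matrix.trace_sub, ← Matrix.sub_mul]
        congr 2
        ext i j
        simp
      rw [h3, h2]
      push_cast
      ring
    exact hTne (sub_eq_zero.1 (eq_zero_of_trace_directionMatrix ht
      ((hsymm T hT).sub (hsymm T₀ hb0)) _ hr))

/-! ### Fourier coefficients under block diagonal similitudes -/

section

variable {K : Type*} [Field K] {n : ℕ}

/-- The change of variables `S ↦ β⁻¹ ᵗM S M` on Fourier indices. -/
def indexEquiv (β : Kˣ) (M : GL (Fin n) K) :
    Matrix (Fin n) (Fin n) K ≃ Matrix (Fin n) (Fin n) K where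
  toFun S := (β : K)⁻¹ • (M.1.transpose * S * M.1)
  invFun T := (β : K) • ((M⁻¹).1.transpose * T * (M⁻¹).1)
  left_inv S := by
    have h1 : (M⁻¹).1.transpose * M.1.transpose = 1 := by
      rw [← Matrix.transpose_mul, ← Units.val_mul, mul_inv_cancel, Units.val_one,
        Matrix.transpose_one]
    have h2 : M.1 * (M⁻¹).1 = 1 := by rw [← Units.val_mul, mul_inv_cancel, Units.val_one]
    simp only [Matrix.mul_smul, Matrix.smul_mul, smul_smul, one_smul,
      mul_inv_cancel₀ (Units.ne_zero β)]
    rw [← Matrix.mul_assoc, ← Matrix.mul_assoc, h1, Matrix.one_mul, Matrix.mul_assoc, h2,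
      Matrix.mul_one]
  right_inv S := by
    have h1 : M.1.transpose * (M⁻¹).1.transpose = 1 := by
      rw [← Matrix.transpose_mul, ← Units.val_mul, inv_mul_cancel, Units.val_one,
        Matrix.transpose_one]
    have h2 : (M⁻¹).1 * M.1 = 1 := by rw [← Units.val_mul, inv_mul_cancel, Units.val_one]
    simp only [Matrix.mul_smul, Matrix.smul_mul, smul_smul, one_smul,
      inv_mul_cancel₀ (Units.ne_zero β)]
    rw [← Matrix.mul_assoc, ← Matrix.mul_assoc, h1, Matrix.one_mul, Matrix.mul_assoc, h2,
      Matrix.mul_one]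

lemma IsPosSemidef.indexEquiv {β : Kˣ} (hβ : TotPos (β : K)) (M : GL (Fin n) K)
    {S : Matrix (Fin n) (Fin n) K} (hS : IsPosSemidef S) :
    IsPosSemidef (indexEquiv β M S) := by
  refine ⟨?_, fun σ => ?_⟩
  · simp [HilbertSiegel.indexEquiv, Matrix.IsSymm, Matrix.transpose_mul, hS.1.eq, Matrix.mul_assoc]
  · have h : (HilbertSiegel.indexEquiv β M S).map σ =
        (σ (β : K))⁻¹ • ((M.1.map σ).conjTranspose * S.map σ * M.1.map σ) := by
      rw [Matrix.conjTranspose_eq_transpose_of_trivial, ← Matrix.transpose_map, ← Matrix.map_mul,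
        ← Matrix.map_mul]
      ext i j
      simp only [HilbertSiegel.indexEquiv, Equiv.coe_fn_mk, Matrix.map_apply, Matrix.smul_apply,
        smul_eq_mul, map_mul, map_inv₀]
    rw [h]
    exact ((hS.2 σ).conjTranspose_mul_mul_same _).smul (inv_pos.2 (hβ σ)).le

end

lemma expT_levi {β : Kˣ} (hβ : TotPos (β : K)) (M : GL (Fin n) K)
    (S : Matrix (Fin n) (Fin n) K) (τ : HalfSpace K n) :
    expT S (levi β hβ M τ) = expT (indexEquiv β M S) τ := by
  rw [expT, expT, Matrix.trace_sum, Matrix.trace_sum]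
  congr 2
  refine Finset.sum_congr rfl fun σ _ => ?_
  simp only [levi, indexEquiv, Equiv.coe_fn_mk, conjMatrix_smul, conjMatrix_mul,
    conjMatrix_transpose, Matrix.smul_mul, Matrix.mul_smul, Matrix.trace_smul]
  congr 1
  rw [← Matrix.mul_assoc, Matrix.trace_mul_comm]
  simp only [Matrix.mul_assoc]

/-- The effect of the operator of `diag(β⁻¹ M, ᵗM⁻¹)` on Fourier coefficients. -/
lemma IsFourierExpansion.apply_indexEquiv [IsTotallyReal K] {k : ℤ} {β : Kˣ} {M : GL (Fin n) K}
    {f f' : HalfSpace K n → ℂ} {a a' : Matrix (Fin n) (Fin n) K → ℂ}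
    (hf : IsFourierExpansion f a) (hf' : IsFourierExpansion f' a')
    (h : IsLeviSlash k β M f f') (S : Matrix (Fin n) (Fin n) K) :
    a' (indexEquiv β M S) = leviFactor k β M * a S := by
  obtain ⟨hβ, h⟩ := h
  have h2 : IsFourierExpansion f'
      (fun T => leviFactor k β M * a ((indexEquiv β M).symm T)) := by
    refine ⟨fun T hT => ?_, fun τ => ?_⟩
    · have hS : ¬ IsPosSemidef ((indexEquiv β M).symm T) := fun hp =>
        hT (by simpa using hp.indexEquiv hβ M)
      simp only [hf.1 _ hS, mul_zero]
    · rw [h τ, ← (indexEquiv β M).hasSum_iff]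
      refine ((hf.2 (levi β hβ M τ)).mul_left (leviFactor k β M : ℂ)).congr_fun fun S => ?_
      simp only [Function.comp_apply, Equiv.symm_apply_apply]
      rw [expT_levi, mul_assoc]
  rw [hf'.unique h2]
  simp

/-! ### Matrices between tuples of fractional ideals -/

section

variable {K : Type*} [Field K]

lemma sum_mem_fracIdeal {ι : Type*} (s : Finset ι) {I : FractionalIdeal (𝓞 K)⁰ K} {g : ι → K}
    (h : ∀ i ∈ s, g i ∈ I) : ∑ i ∈ s, g i ∈ I := by
  rw [← FractionalIdeal.mem_coe]
  exact Submodule.sum_mem _ h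

lemma neg_mem_fracIdeal {I : FractionalIdeal (𝓞 K)⁰ K} {a : K} (h : a ∈ I) : -a ∈ I := by
  rw [← FractionalIdeal.mem_coe] at h ⊢
  exact Submodule.neg_mem _ h

lemma zero_mem_fracIdeal (I : FractionalIdeal (𝓞 K)⁰ K) : (0 : K) ∈ I := by
  rw [← FractionalIdeal.mem_coe]
  exact Submodule.zero_mem _

variable {n : ℕ}

lemma embedTwo_mul {l m : Fin n} (hlm : l ≠ m) (A A' : Matrix (Fin 2) (Fin 2) K) :
    embedTwo l m A * embedTwo l m A' = embedTwo l m (A * A') := by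
  ext i j
  rw [Matrix.mul_apply]
  by_cases hi : i = l ∨ i = m
  · rw [Finset.sum_eq_add l m hlm]
    · rcases hi with hi | hi <;> by_cases h2 : j = l <;> by_cases h3 : j = m <;>
        simp_all [embedTwo, Matrix.mul_apply, Fin.sum_univ_two]
      all_goals grind
    · intro b _ hb
      rcases hi with rfl | rfl <;> simp_all [embedTwo, eq_comm]
    · simp
    · simp
  · rw [Finset.sum_eq_single i]
    · push Not at hi
      simp [embedTwo, hi]
    · intro b _ hb
      push Not at hi
      simp [embedTwo, hi, hb.symm]
    · simp

lemma embedTwo_one {l m : Fin n} (hlm : l ≠ m) :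
    embedTwo l m (1 : Matrix (Fin 2) (Fin 2) K) = 1 := by
  ext i j
  simp only [embedTwo, Matrix.of_apply, Matrix.one_apply]
  split_ifs <;> grind

end

lemma mul_mem_fracIdeal {I J : FracIdeal K} {a b : K} (ha : a ∈ (I : FractionalIdeal (𝓞 K)⁰ K))
    (hb : b ∈ (J : FractionalIdeal (𝓞 K)⁰ K)) :
    a * b ∈ ((I * J : FracIdeal K) : FractionalIdeal (𝓞 K)⁰ K) := by
  rw [Units.val_mul]
  exact FractionalIdeal.mul_mem_mul ha hb

lemma one_mem_fracIdeal : (1 : K) ∈ ((1 : FracIdeal K) : FractionalIdeal (𝓞 K)⁰ K) := by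
  rw [Units.val_one]
  exact FractionalIdeal.one_mem_one _

lemma mem_toPrincipalIdeal_self (α : Kˣ) :
    (α : K) ∈ (toPrincipalIdeal (𝓞 K) K α : FractionalIdeal (𝓞 K)⁰ K) := by
  rw [coe_toPrincipalIdeal]
  exact FractionalIdeal.mem_spanSingleton_self _ _

lemma toPrincipalIdeal_le_iff {α : Kˣ} {I : FracIdeal K} :
    (toPrincipalIdeal (𝓞 K) K α : FractionalIdeal (𝓞 K)⁰ K) ≤ I ↔
      (α : K) ∈ (I : FractionalIdeal (𝓞 K)⁰ K) := by
  rw [coe_toPrincipalIdeal, FractionalIdeal.spanSingleton_le_iff_mem]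

/-- `M_{ij} ∈ I_i I'_j⁻¹`: for bases with `x' = x M` this says that `⨁ I'_j x'_j ⊆ ⨁ I_i x_i`. -/
def EntriesIn (M : Matrix (Fin n) (Fin n) K) (I I' : Fin n → FracIdeal K) : Prop :=
  ∀ i j, M i j ∈ ((I i * (I' j)⁻¹ : FracIdeal K) : FractionalIdeal (𝓞 K)⁰ K)

lemma EntriesIn.mul {M N : Matrix (Fin n) (Fin n) K} {I I' I'' : Fin n → FracIdeal K}
    (hM : EntriesIn M I I') (hN : EntriesIn N I' I'') : EntriesIn (M * N) I I'' := fun i j => by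
  rw [Matrix.mul_apply]
  refine sum_mem_fracIdeal _ fun l _ => ?_
  simpa only [inv_mul_cancel_left, mul_assoc] using mul_mem_fracIdeal (hM i l) (hN l j)

lemma EntriesIn.one (I : Fin n → FracIdeal K) : EntriesIn 1 I I := fun i j => by
  rcases eq_or_ne i j with rfl | h
  · simp
  · rw [Matrix.one_apply_ne h]
    exact zero_mem_fracIdeal _

/-- The determinant of a matrix with entries in `I_i I'_j⁻¹` lies in `∏ I_i ∏ I'_j⁻¹`. -/
lemma EntriesIn.det_mem {M : Matrix (Fin n) (Fin n) K} {I I' : Fin n → FracIdeal K}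
    (hM : EntriesIn M I I') :
    M.det ∈ (((∏ i, I i) * (∏ i, I' i)⁻¹ : FracIdeal K) : FractionalIdeal (𝓞 K)⁰ K) := by
  rw [Matrix.det_apply']
  refine sum_mem_fracIdeal _ fun s _ => ?_
  have hprod : ∀ t : Finset (Fin n), ∏ i ∈ t, M (s i) i ∈
      ((∏ i ∈ t, (I (s i) * (I' i)⁻¹) : FracIdeal K) : FractionalIdeal (𝓞 K)⁰ K) := by
    intro t
    induction t using Finset.induction_on with
    | empty => simp
    | insert a t ha ih =>
      rw [Finset.prod_insert ha, Finset.prod_insert ha]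
      exact mul_mem_fracIdeal (hM _ _) ih
  have h := hprod Finset.univ
  rw [Finset.prod_mul_distrib, Equiv.prod_comp s I, Finset.prod_inv_distrib] at h
  rcases Int.units_eq_one_or (Equiv.Perm.sign s) with hs | hs
  · simpa [hs] using h
  · simpa [hs] using neg_mem_fracIdeal h

lemma prod_eq_toPrincipalIdeal_det_mul {M : GL (Fin n) K} {I I' : Fin n → FracIdeal K}
    (hM : EntriesIn M.1 I I') (hM' : EntriesIn (M⁻¹).1 I' I) :
    (∏ i, I i) = toPrincipalIdeal (𝓞 K) K (Matrix.GeneralLinearGroup.det M) * ∏ i, I' i := by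
  rw [← mul_inv_eq_iff_eq_mul]
  refine le_antisymm ?_ (toPrincipalIdeal_le_iff.2 hM.det_mem)
  have h : (toPrincipalIdeal (𝓞 K) K (Matrix.GeneralLinearGroup.det M⁻¹) :
      FractionalIdeal (𝓞 K)⁰ K) ≤ (((∏ i, I' i) * (∏ i, I i)⁻¹ : FracIdeal K)) :=
    toPrincipalIdeal_le_iff.2 hM'.det_mem
  rw [← Units.val_le_val]
  set P := ((∏ i, I i) * (∏ i, I' i)⁻¹ : FracIdeal K)
  have hP : ((∏ i, I' i) * (∏ i, I i)⁻¹ : FracIdeal K) = P⁻¹ := by simp [P]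
  rw [hP, map_inv, map_inv] at h
  set D := toPrincipalIdeal (𝓞 K) K (Matrix.GeneralLinearGroup.det M)
  calc (P : FractionalIdeal (𝓞 K)⁰ K) = P * (D * ((D⁻¹ : FracIdeal K) : FractionalIdeal (𝓞 K)⁰ K)) := by
        rw [Units.mul_inv, mul_one]
    _ ≤ P * (D * ((P⁻¹ : FracIdeal K) : FractionalIdeal (𝓞 K)⁰ K)) := by gcongr
    _ = D := by rw [mul_left_comm, Units.mul_inv, mul_one]

/-! ### The maps between spaces of modular forms as similitudes -/

/-- The form `L'` arises from `L` by the operator of `diag(β⁻¹ M, ᵗM⁻¹)`, where `β` and `M`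
transform the tuple of `L` into the tuple of `L'`. Compositions of the maps `U_l`, `W` and `V_l`
are of this kind. -/
structure IsTransport (k : ℤ) (L L' : LabelledForm K n) (β : Kˣ) (M : GL (Fin n) K) : Prop where
  J_eq : L'.J = toPrincipalIdeal (𝓞 K) K β * L.J
  entries : EntriesIn M.1 L.I L'.I
  entries_inv : EntriesIn (M⁻¹).1 L'.I L.I
  isLeviSlash : IsLeviSlash k β M L.f L'.f

lemma IsTransport.refl (k : ℤ) (L : LabelledForm K n) : IsTransport k L L 1 1 :=
  ⟨by simp, EntriesIn.one _, by simpa using EntriesIn.one _, IsLeviSlash.refl _ _⟩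

lemma IsTransport.trans {k : ℤ} {L L' L'' : LabelledForm K n} {β γ : Kˣ} {M N : GL (Fin n) K}
    (h : IsTransport k L L' β M) (h' : IsTransport k L' L'' γ N) :
    IsTransport k L L'' (β * γ) (M * N) := by
  refine ⟨?_, h.entries.mul h'.entries, ?_, h.isLeviSlash.trans h'.isLeviSlash⟩
  · rw [h'.J_eq, h.J_eq, map_mul, ← mul_assoc, mul_comm (toPrincipalIdeal (𝓞 K) K γ)]
  · rw [mul_inv_rev]
    exact h'.entries_inv.mul h.entries_inv

lemma IsTransport.symm {k : ℤ} {L L' : LabelledForm K n} {β : Kˣ} {M : GL (Fin n) K}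
    (h : IsTransport k L L' β M) : IsTransport k L' L β⁻¹ M⁻¹ :=
  ⟨by rw [h.J_eq, map_inv, inv_mul_cancel_left], h.entries_inv,
    by rw [inv_inv]; exact h.entries, h.isLeviSlash.symm⟩

/-- Every one of the maps `U_l`, `W`, `V_l` is the operator of a matrix `diag(β⁻¹ M, ᵗM⁻¹)`. -/
lemma Step.exists_isTransport {k : ℤ} {L L' : LabelledForm K n} (h : Step k L L') :
    ∃ β M, IsTransport k L L' β M := by
  cases h with
  | U I J f l α =>
    have hentries : ∀ (γ : Kˣ) (I : Fin n → FracIdeal K),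
        EntriesIn (Matrix.diagonal (Function.update 1 l ((γ⁻¹ : Kˣ) : K))) I
          (Function.update I l (toPrincipalIdeal (𝓞 K) K γ * I l)) := fun γ I i j => by
      rcases eq_or_ne i j with rfl | hij
      · rw [Matrix.diagonal_apply_eq]
        rcases eq_or_ne i l with rfl | hil
        · rw [Function.update_self, Function.update_self, mul_inv_rev, mul_inv_cancel_left,
            ← map_inv]
          exact mem_toPrincipalIdeal_self _
        · rw [Function.update_of_ne hil, Function.update_of_ne hil, mul_inv_cancel]
          exact one_mem_fracIdeal
      · rw [Matrix.diagonal_apply_ne _ hij]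
        exact zero_mem_fracIdeal _
    have hprod : ∀ γ : Kˣ, Matrix.diagonal (Function.update 1 l ((γ⁻¹ : Kˣ) : K)) *
        Matrix.diagonal (Function.update 1 l (γ : K)) = 1 := fun γ => by
      rw [Matrix.diagonal_mul_diagonal, ← Matrix.diagonal_one]
      congr 1
      funext i
      rcases eq_or_ne i l with rfl | hil
      · simp
      · simp [hil]
    let M : GL (Fin n) K := ⟨Matrix.diagonal (Function.update 1 l ((α⁻¹ : Kˣ) : K)),
      Matrix.diagonal (Function.update 1 l (α : K)), hprod α, by simpa using hprod α⁻¹⟩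
    refine ⟨1, M, by simp, hentries α I, ?_, ?_⟩
    · have h := hentries α⁻¹ (Function.update I l (toPrincipalIdeal (𝓞 K) K α * I l))
      simpa [M, ← Matrix.coe_units_inv] using h
    · have h := isLeviSlash_slash k (β := 1) (by simpa using totPos_one) M f
      simpa [diagBlock, M] using h
  | W I J f α hα =>
    refine ⟨α, 1, rfl, EntriesIn.one _, by simpa using EntriesIn.one _, ?_⟩
    simpa using isLeviSlash_slash k hα 1 f
  | V I J f l m hlm Q A hA h00 h01 h10 h11 =>
    have hne : l ≠ m := fun h => by
      rw [h] at hlm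
      omega
    have h1 : embedTwo l m A * embedTwo l m A.adjugate = 1 := by
      rw [embedTwo_mul hne, Matrix.mul_adjugate, hA, one_smul, embedTwo_one hne]
    have h2 : embedTwo l m A.adjugate * embedTwo l m A = 1 := by
      rw [embedTwo_mul hne, Matrix.adjugate_mul, hA, one_smul, embedTwo_one hne]
    have hentries : ∀ (I I' : Fin n → FracIdeal K) (A : Matrix (Fin 2) (Fin 2) K),
        A 0 0 ∈ ((I l * (I' l)⁻¹ : FracIdeal K) : FractionalIdeal (𝓞 K)⁰ K) →
        A 0 1 ∈ ((I l * (I' m)⁻¹ : FracIdeal K) : FractionalIdeal (𝓞 K)⁰ K) →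
        A 1 0 ∈ ((I m * (I' l)⁻¹ : FracIdeal K) : FractionalIdeal (𝓞 K)⁰ K) →
        A 1 1 ∈ ((I m * (I' m)⁻¹ : FracIdeal K) : FractionalIdeal (𝓞 K)⁰ K) →
        (∀ i, i ≠ l → i ≠ m → I i = I' i) → EntriesIn (embedTwo l m A) I I' := by
      intro I I' A h00 h01 h10 h11 hI i j
      rw [embedTwo, Matrix.of_apply]
      split_ifs with c1 c2 c3 c4 c5
      · rwa [c1.1, c1.2]
      · rwa [c2.1, c2.2]
      · rwa [c3.1, c3.2]
      · rwa [c4.1, c4.2]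
      · subst c5
        rw [hI i (fun h => c1 ⟨h, h⟩) (fun h => c4 ⟨h, h⟩), mul_inv_cancel]
        exact one_mem_fracIdeal
      · exact zero_mem_fracIdeal _
    refine ⟨1, ⟨_, _, h1, h2⟩, by simp, ?_, ?_, ?_⟩
    · apply hentries <;> dsimp only
      · simpa [hne] using h00
      · simpa [mul_comm, mul_left_comm, mul_assoc] using h01
      · simpa [hne, mul_comm, mul_left_comm] using h10
      · simpa using h11
      · intro i hl hm
        simp [hl, hm]
    · show EntriesIn (embedTwo l m A.adjugate) _ _
      rw [Matrix.adjugate_fin_two]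
      apply hentries <;> dsimp only
      · simpa [hne] using h11
      · simpa [hne] using neg_mem_fracIdeal h01
      · simpa [hne, mul_comm, mul_left_comm, mul_assoc] using neg_mem_fracIdeal h10
      · simpa using h00
      · intro i hl hm
        simp [hl, hm]
    · have h := isLeviSlash_slash k (β := 1) (by simpa using totPos_one)
        (⟨_, _, h1, h2⟩ : GL (Fin n) K) f
      simpa [diagBlock] using h

lemma Equivalent.exists_isTransport {k : ℤ} {L L' : LabelledForm K n} (h : Equivalent k L L') :
    ∃ β M, IsTransport k L L' β M := by
  induction h with
  | refl => exact ⟨1, 1, IsTransport.refl k L⟩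
  | tail _ hstep ih =>
    obtain ⟨β, M, h⟩ := ih
    obtain ⟨γ, N, h'⟩ := hstep.exists_isTransport
    exact ⟨_, _, h.trans h'⟩

/-! ### Connecting tuples of ideals -/

lemma exists_ne_zero_mem_fracIdeal (I : FracIdeal K) :
    ∃ d : K, d ≠ 0 ∧ d ∈ (I : FractionalIdeal (𝓞 K)⁰ K) := by
  by_contra! h
  refine I.ne_zero (FractionalIdeal.eq_zero_iff.2 fun x hx => ?_)
  by_contra h0
  exact h x h0 hx

/-- The matrices that enter the definition of `V_l(Q)` exist. -/
lemma exists_det_eq_one (Q R : FracIdeal K) :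
    ∃ A : Matrix (Fin 2) (Fin 2) K, A.det = 1 ∧
      A 0 0 ∈ ((Q⁻¹ : FracIdeal K) : FractionalIdeal (𝓞 K)⁰ K) ∧
      A 0 1 ∈ (R : FractionalIdeal (𝓞 K)⁰ K) ∧
      A 1 0 ∈ ((R⁻¹ : FracIdeal K) : FractionalIdeal (𝓞 K)⁰ K) ∧
      A 1 1 ∈ (Q : FractionalIdeal (𝓞 K)⁰ K) := by
  obtain ⟨d, hd0, hd⟩ := exists_ne_zero_mem_fracIdeal Q
  -- Choose `x ∈ R` such that the integral ideals `d Q⁻¹` and `x R⁻¹` are coprime.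
  let δ : Kˣ := Units.mk0 d hd0
  have hle : ((toPrincipalIdeal (𝓞 K) K δ * Q⁻¹ : FracIdeal K) : FractionalIdeal (𝓞 K)⁰ K) ≤ 1 := by
    rw [Units.val_mul, ← Units.mul_inv Q]
    gcongr
    exact toPrincipalIdeal_le_iff.2 hd
  obtain ⟨x, hx⟩ := IsDedekindDomain.exists_add_spanSingleton_mul_eq hle (Units.ne_zero _)
    (Units.ne_zero (R⁻¹ : FracIdeal K))
  have h1 : (1 : K) ∈ (1 : FractionalIdeal (𝓞 K)⁰ K) := FractionalIdeal.one_mem_one _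
  have hxR : x ∈ (R : FractionalIdeal (𝓞 K)⁰ K) := by
    rw [← FractionalIdeal.spanSingleton_le_iff_mem]
    calc FractionalIdeal.spanSingleton (𝓞 K)⁰ x
        = FractionalIdeal.spanSingleton (𝓞 K)⁰ x * ((R⁻¹ : FracIdeal K) :
            FractionalIdeal (𝓞 K)⁰ K) * R := by rw [mul_assoc, Units.inv_mul, mul_one]
      _ ≤ 1 * R := by
        gcongr
        rw [← hx]
        exact le_add_of_nonneg_left zero_le
      _ = R := one_mul _
  rw [← hx, FractionalIdeal.mem_add] at h1
  obtain ⟨u, hu, v, hv, huv⟩ := h1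
  rw [Units.val_mul, coe_toPrincipalIdeal, FractionalIdeal.mem_singleton_mul] at hu
  obtain ⟨q, hq, rfl⟩ := hu
  obtain ⟨r, hr, rfl⟩ := FractionalIdeal.mem_singleton_mul.1 hv
  refine ⟨!![q, -x; r, d], ?_, hq, neg_mem_fracIdeal hxR, hr, hd⟩
  rw [Matrix.det_fin_two_of, ← huv]
  simp only [δ, Units.val_mk0]
  ring

lemma exists_step_V (k : ℤ) (I : Fin n → FracIdeal K) (J : FracIdeal K) (f : HalfSpace K n → ℂ)
    (l m : Fin n) (hlm : (m : ℕ) = l + 1) (Q : FracIdeal K) :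
    ∃ g, Step k ⟨I, J, f⟩
      ⟨Function.update (Function.update I l (Q * I l)) m (Q⁻¹ * I m), J, g⟩ := by
  obtain ⟨A, hA, h00, h01, h10, h11⟩ := exists_det_eq_one Q (Q * I l * (I m)⁻¹)
  refine ⟨_, Step.V I J f l m hlm Q A hA h00 h01 ?_ h11⟩
  convert h10 using 3
  simp [mul_comm]

/-- With the maps `V_l` one can prescribe the first `j < n` ideals of a tuple, keeping the
product. -/
lemma exists_equivalent_prefix (k : ℤ) (I I' : Fin n → FracIdeal K) (J : FracIdeal K)
    (f : HalfSpace K n → ℂ) (j : ℕ) (hj : j + 1 ≤ n) :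
    ∃ I'' g, Equivalent k ⟨I, J, f⟩ ⟨I'', J, g⟩ ∧ (∀ i : Fin n, (i : ℕ) < j → I'' i = I' i) ∧
      ∏ i, I'' i = ∏ i, I i := by
  induction j with
  | zero => exact ⟨I, f, Relation.ReflTransGen.refl, by simp, rfl⟩
  | succ j ih =>
    obtain ⟨I₁, g₁, h₁, hI₁, hp⟩ := ih (by omega)
    let l : Fin n := ⟨j, by omega⟩
    let m : Fin n := ⟨j + 1, by omega⟩
    have hne : l ≠ m := by simp [l, m]
    let Q := I' l * (I₁ l)⁻¹
    obtain ⟨g, hg⟩ := exists_step_V k I₁ J g₁ l m rfl Q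
    refine ⟨_, g, h₁.tail hg, fun i hi => ?_, ?_⟩
    · have him : i ≠ m := fun h => by
        rw [h] at hi
        simp [m] at hi
      rw [Function.update_of_ne him]
      rcases eq_or_ne i l with rfl | hil
      · rw [Function.update_self, inv_mul_cancel_right]
      · rw [Function.update_of_ne hil]
        apply hI₁
        have : (i : ℕ) ≠ j := fun h => hil (Fin.ext h)
        omega
    · have hup : Function.update (Function.update I₁ l (Q * I₁ l)) m (Q⁻¹ * I₁ m) =
          fun i => (Pi.mulSingle l Q : Fin n → FracIdeal K) i *
            (Pi.mulSingle m Q⁻¹ : Fin n → FracIdeal K) i * I₁ i := by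
        funext i
        rcases eq_or_ne i m with rfl | him
        · simp [Pi.mulSingle_eq_of_ne hne.symm]
        · rw [Function.update_of_ne him, Pi.mulSingle_eq_of_ne him, mul_one]
          rcases eq_or_ne i l with rfl | hil
          · simp
          · simp [hil]
      rw [hup, Finset.prod_mul_distrib, Finset.prod_mul_distrib, hp,
        Finset.prod_pi_mulSingle', Finset.prod_pi_mulSingle']
      simp

/-- The maps `U_l` and `V_l` connect any two tuples whose products are in the same ideal class. -/
lemma exists_equivalent (k : ℤ) (hn : 1 ≤ n) (I I' : Fin n → FracIdeal K) (J : FracIdeal K)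
    (f : HalfSpace K n → ℂ) (α : Kˣ)
    (h : ∏ i, I' i = toPrincipalIdeal (𝓞 K) K α * ∏ i, I i) :
    ∃ g, Equivalent k ⟨I, J, f⟩ ⟨I', J, g⟩ := by
  obtain ⟨N, rfl⟩ : ∃ N, n = N + 1 := ⟨n - 1, by omega⟩
  obtain ⟨I'', g, hg, hI, hp⟩ := exists_equivalent_prefix k I I' J f N le_rfl
  have hlast : Function.update I'' (Fin.last N)
      (toPrincipalIdeal (𝓞 K) K α * I'' (Fin.last N)) = I' := by
    funext i
    induction i using Fin.lastCases with
    | last =>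
      rw [Function.update_self]
      rw [← hp, Fin.prod_univ_castSucc, Fin.prod_univ_castSucc,
        Finset.prod_congr rfl fun i _ => hI (Fin.castSucc i) (by simp), mul_left_comm] at h
      exact (mul_left_cancel h).symm
    | cast i =>
      rw [Function.update_of_ne (Fin.castSucc_lt_last i).ne]
      exact hI _ (by simp)
  have hstep := Step.U (k := k) I'' J g (Fin.last N) α
  rw [hlast] at hstep
  exact ⟨_, hg.tail hstep⟩

/-! ### Decompositions of lattices -/

section Lattices

variable {V : Type*} [AddCommGroup V] [Module K V] [Module (𝓞 K) V]

/-- The first basis vector of a decomposition may be rescaled so as to adjust the orientation. -/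
lemma IsDecomposition.exists_oriented (hn : 1 ≤ n) {Λ : Submodule (𝓞 K) V}
    {x : Module.Basis (Fin n) K V} {I : Fin n → FracIdeal K} (h : IsDecomposition Λ x I)
    (o : VOrientation K n V) :
    ∃ (x' : Module.Basis (Fin n) K V) (I' : Fin n → FracIdeal K),
      Quotient.mk (orientationSetoid K n V) x' = o ∧ IsDecomposition Λ x' I' := by
  induction o using Quotient.inductionOn with
  | h y =>
    have hdet : (x.toMatrix y).det * (y.toMatrix x).det = 1 := by
      rw [← Matrix.det_mul, Module.Basis.toMatrix_mul_toMatrix_flip, Matrix.det_one]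
    -- Scaling the first vector by `α` makes the change of basis to `y` have determinant `1`.
    let α : Kˣ := Units.mk0 _ (left_ne_zero_of_mul_eq_one hdet)
    let i₀ : Fin n := ⟨0, hn⟩
    let w : Fin n → Kˣ := Function.update 1 i₀ α
    refine ⟨x.unitsSMul w, fun i => toPrincipalIdeal (𝓞 K) K (w i)⁻¹ * I i, Quotient.sound ?_, ?_⟩
    · have h1 : (x.toMatrix (x.unitsSMul w)).det = α := by
        rw [Module.Basis.toMatrix_unitsSMul, Matrix.det_diagonal]
        simp only [Function.comp_apply, w]
        rw [← Units.coe_prod, Finset.prod_update_of_mem (Finset.mem_univ _)]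
        simp
      have h2 : (α : K) * ((x.unitsSMul w).toMatrix y).det = α := by
        rw [← h1, ← Matrix.det_mul, Module.Basis.toMatrix_mul_toMatrix, h1]
        rfl
      have h3 : ((x.unitsSMul w).toMatrix y).det = 1 := by
        simpa using h2
      show TotPos _
      rw [h3]
      exact totPos_one
    · intro v
      rw [h v]
      refine forall_congr' fun i => ?_
      rw [Module.Basis.repr_unitsSMul]
      constructor
      · intro hv
        exact mul_mem_fracIdeal (mem_toPrincipalIdeal_self (w i)⁻¹) hv
      · intro hv
        have := mul_mem_fracIdeal (mem_toPrincipalIdeal_self (w i)) hv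
        dsimp only at this
        rwa [Units.smul_def, smul_eq_mul, Units.mul_inv_cancel_left, map_inv,
          mul_inv_cancel_left] at this

lemma IsDecomposition.exists_oriented_of_odd (hn : 1 ≤ n) {k : ℤ} {Λ : Submodule (𝓞 K) V}
    {x : Module.Basis (Fin n) K V} {I : Fin n → FracIdeal K} (h : IsDecomposition Λ x I)
    (ω : Odd k → VOrientation K n V) :
    ∃ (x : Module.Basis (Fin n) K V) (I : Fin n → FracIdeal K),
      (∀ hk : Odd k, Quotient.mk (orientationSetoid K n V) x = ω hk) ∧ IsDecomposition Λ x I := by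
  by_cases hk : Odd k
  · obtain ⟨x', I', hx', h'⟩ := h.exists_oriented hn (ω hk)
    exact ⟨x', I', fun _ => hx', h'⟩
  · exact ⟨x, I, fun h => absurd h hk, h⟩

lemma IsDecomposition.smul_mem {Λ : Submodule (𝓞 K) V} {x : Module.Basis (Fin n) K V}
    {I : Fin n → FracIdeal K} (h : IsDecomposition Λ x I) (j : Fin n) {b : K}
    (hb : b ∈ (I j : FractionalIdeal (𝓞 K)⁰ K)) : b • x j ∈ Λ := by
  rw [h]
  intro i
  rw [map_smul, Module.Basis.repr_self, Finsupp.smul_single, smul_eq_mul, mul_one]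
  rcases eq_or_ne j i with rfl | hij
  · rwa [Finsupp.single_eq_same]
  · rw [Finsupp.single_eq_of_ne' hij]
    exact zero_mem_fracIdeal _

lemma IsDecomposition.entriesIn {Λ : Submodule (𝓞 K) V} {x x' : Module.Basis (Fin n) K V}
    {I I' : Fin n → FracIdeal K} (h : IsDecomposition Λ x I) (h' : IsDecomposition Λ x' I') :
    EntriesIn (x.toMatrix x') I I' := fun i j => by
  have hle : FractionalIdeal.spanSingleton (𝓞 K)⁰ (x.toMatrix x' i j) * I' j ≤ I i := by
    rw [FractionalIdeal.spanSingleton_mul_le_iff]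
    intro b hb
    have := (h _).1 (h'.smul_mem j hb) i
    rwa [map_smul, Finsupp.smul_apply, smul_eq_mul, mul_comm] at this
  rw [← FractionalIdeal.spanSingleton_le_iff_mem, Units.val_mul]
  calc FractionalIdeal.spanSingleton (𝓞 K)⁰ (x.toMatrix x' i j)
      = FractionalIdeal.spanSingleton (𝓞 K)⁰ (x.toMatrix x' i j) * I' j *
          (((I' j)⁻¹ : FracIdeal K) : FractionalIdeal (𝓞 K)⁰ K) := by
        rw [mul_assoc, Units.mul_inv, mul_one]
    _ ≤ _ := by gcongr

variable [IsScalarTower (𝓞 K) K V]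

/-- If the image of `Λ` under a linear form contains the fractional ideal `I`, then the form has a
splitting `I → Λ`, `c ↦ c y`, because `I` is invertible: write `1 ∈ I I⁻¹` as a sum of products. -/
lemma exists_section (Λ : Submodule (𝓞 K) V) (φ : V →ₗ[K] K) (I : FracIdeal K)
    (hI : ∀ c ∈ (I : FractionalIdeal (𝓞 K)⁰ K), ∃ v ∈ Λ, φ v = c) :
    ∃ y, φ y = 1 ∧ ∀ b ∈ (I : FractionalIdeal (𝓞 K)⁰ K), b • y ∈ Λ := by
  have key : ∀ c ∈ (I : FractionalIdeal (𝓞 K)⁰ K) * ((I⁻¹ : FracIdeal K) :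
      FractionalIdeal (𝓞 K)⁰ K), ∃ y, φ y = c ∧
        ∀ b ∈ (I : FractionalIdeal (𝓞 K)⁰ K), b • y ∈ Λ := by
    intro c hc
    refine FractionalIdeal.mul_induction_on hc ?_ ?_
    · intro i hi j hj
      obtain ⟨v, hv, rfl⟩ := hI i hi
      refine ⟨j • v, by simp [mul_comm], fun b hb => ?_⟩
      have hbj := FractionalIdeal.mul_mem_mul hb hj
      rw [Units.mul_inv, FractionalIdeal.mem_one_iff] at hbj
      obtain ⟨r, hr⟩ := hbj
      rw [smul_smul, ← hr, algebraMap_smul]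
      exact Λ.smul_mem r hv
    · rintro _ _ ⟨y, rfl, hy⟩ ⟨y', rfl, hy'⟩
      refine ⟨y + y', by simp, fun b hb => ?_⟩
      rw [smul_add]
      exact Λ.add_mem (hy b hb) (hy' b hb)
  apply key
  rw [Units.mul_inv]
  exact FractionalIdeal.one_mem_one _

lemma exists_smul_mem_of_isLattice (Λ : Submodule (𝓞 K) V) [Submodule.IsLattice K Λ] (v : V) :
    ∃ c : 𝓞 K, c ≠ 0 ∧ c • v ∈ Λ := by
  have hv : v ∈ Submodule.span K (Λ : Set V) := by
    rw [Submodule.IsLattice.span_eq_top]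
    trivial
  induction hv using Submodule.span_induction with
  | mem v hv => exact ⟨1, one_ne_zero, by simpa using hv⟩
  | zero => exact ⟨1, one_ne_zero, by simp⟩
  | add v w _ _ hv hw =>
    obtain ⟨c, hc, hcv⟩ := hv
    obtain ⟨d, hd, hdw⟩ := hw
    refine ⟨d * c, mul_ne_zero hd hc, ?_⟩
    rw [smul_add, mul_smul, mul_comm d c, mul_smul]
    exact Λ.add_mem (Λ.smul_mem d hcv) (Λ.smul_mem c hdw)
  | smul a v _ hv =>
    obtain ⟨c, hc, hcv⟩ := hv
    obtain ⟨r, s, hs, rfl⟩ := IsFractionRing.div_surjective (A := 𝓞 K) a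
    have hs0 : s ≠ 0 := nonZeroDivisors.ne_zero hs
    refine ⟨s * c, mul_ne_zero hs0 hc, ?_⟩
    have h : (s * c) • (algebraMap (𝓞 K) K r / algebraMap (𝓞 K) K s) • v = r • c • v := by
      have hs1 : algebraMap (𝓞 K) K s ≠ 0 := by simpa using hs0
      rw [← algebraMap_smul K (s * c), ← algebraMap_smul K r, ← algebraMap_smul K c, smul_smul,
        smul_smul]
      congr 1
      rw [map_mul]
      field_simp
    rw [h]
    exact Λ.smul_mem r hcv

/-- A finitely generated module over the Dedekind domain `𝓞 K` that spans the space `V` is a direct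
sum `I₁ x₁ ⊕ ⋯ ⊕ Iₙ xₙ`: split off the image under a linear form, which is a fractional ideal. -/
theorem exists_isDecomposition_of_fg : ∀ (n : ℕ) {V : Type*} [AddCommGroup V] [Module K V]
    [Module (𝓞 K) V] [IsScalarTower (𝓞 K) K V] [Module.Finite K V]
    (_ : Module.finrank K V = n) (Λ : Submodule (𝓞 K) V) (_ : Λ.FG)
    (_ : ∀ v : V, ∃ c : 𝓞 K, c ≠ 0 ∧ c • v ∈ Λ),
    ∃ (x : Module.Basis (Fin n) K V) (I : Fin n → FracIdeal K), IsDecomposition Λ x I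
  | 0, V, _, _, _, _, _, hV, Λ, _, _ => by
    have : Subsingleton V := Module.finrank_zero_iff.1 hV
    refine ⟨Module.finBasisOfFinrankEq K V hV, fun _ => 1, fun v => ?_⟩
    simp [Subsingleton.elim v 0]
  | n + 1, V, _, _, _, _, _, hV, Λ, hfg, hspan => by
    let b₀ := Module.finBasisOfFinrankEq K V hV
    let φ : V →ₗ[K] K := b₀.coord 0
    have hφ1 : φ (b₀ 0) = 1 := by simp [φ]
    have hφ : φ ≠ 0 := fun h => by simp [h] at hφ1
    let I₀ : FractionalIdeal (𝓞 K)⁰ K := ⟨Λ.map (φ.restrictScalars (𝓞 K)),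
      FractionalIdeal.isFractional_of_fg (hfg.map _)⟩
    have hmem : ∀ c, c ∈ I₀ ↔ ∃ v ∈ Λ, φ v = c := fun c => Iff.rfl
    have hI₀ : I₀ ≠ 0 := fun h => by
      obtain ⟨c, hc, hcv⟩ := hspan (b₀ 0)
      have h1 : φ (c • b₀ 0) ∈ I₀ := (hmem _).2 ⟨_, hcv, rfl⟩
      rw [h, FractionalIdeal.mem_zero_iff, ← algebraMap_smul K c, map_smul, hφ1, smul_eq_mul,
        mul_one] at h1
      exact hc (by simpa using h1)
    let I : FracIdeal K := Units.mk0 I₀ hI₀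
    obtain ⟨y, hy1, hy⟩ := exists_section Λ φ I fun c hc => (hmem c).1 hc
    let W := LinearMap.ker φ
    have hW : Module.finrank K W = n := by
      have := Module.Dual.finrank_ker_add_one_of_ne_zero (f := φ) hφ
      rw [hV] at this
      exact Nat.succ_injective this
    let Λ' : Submodule (𝓞 K) W := Λ.comap (W.subtype.restrictScalars (𝓞 K))
    have hfg' : Λ'.FG := by
      refine Submodule.fg_of_fg_map_injective (W.subtype.restrictScalars (𝓞 K))
        W.subtype_injective (hfg.of_le (Submodule.map_comap_le _ _))
    obtain ⟨x', I', hx'⟩ := exists_isDecomposition_of_fg n hW Λ' hfg' fun v => by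
      obtain ⟨c, hc, hcv⟩ := hspan v
      exact ⟨c, hc, hcv⟩
    let x : Module.Basis (Fin (n + 1)) K V := Module.Basis.mkFinCons y x'
      (fun c w hw h => by
        have := congrArg φ h
        rwa [map_add, map_smul, hy1, LinearMap.mem_ker.1 hw, map_zero, add_zero, smul_eq_mul,
          mul_one] at this)
      (fun z => ⟨-φ z, by simp [W, hy1]⟩)
    have hx0 : x 0 = y := by simp [x]
    have hxs : ∀ i, x (Fin.succ i) = x' i := fun i => by simp [x]
    have hrepr0 : ∀ v, x.repr v 0 = φ v := fun v => by
      conv_rhs => rw [← x.sum_repr v]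
      rw [Fin.sum_univ_succ, map_add, map_sum, map_smul, hx0, hy1]
      simp [hxs, W]
    have hreprs : ∀ v (w : W) i, (w : V) = v - φ v • y → x.repr v (Fin.succ i) = x'.repr w i := by
      intro v w i hw
      have h : w = ∑ i, x.repr v (Fin.succ i) • x' i := by
        apply Subtype.ext
        have e := x.sum_repr v
        rw [Fin.sum_univ_succ, hx0, hrepr0] at e
        rw [hw, sub_eq_iff_eq_add']
        refine e.symm.trans ?_
        simp [hxs]
      rw [h, x'.repr_sum_self]
    refine ⟨x, Fin.cons I I', fun v => ?_⟩
    let w : W := ⟨v - φ v • y, by simp [W, hy1]⟩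
    have hw := hx' w
    rw [Fin.forall_fin_succ, hrepr0]
    simp only [Fin.cons_zero, Fin.cons_succ, fun i => hreprs v w i rfl]
    rw [← hw]
    constructor
    · intro hv
      have h1 : φ v ∈ I₀ := (hmem _).2 ⟨v, hv, rfl⟩
      exact ⟨h1, Λ.sub_mem hv (hy _ h1)⟩
    · rintro ⟨h1, h2⟩
      have h3 : v - φ v • y ∈ Λ := h2
      simpa using Λ.add_mem h3 (hy _ h1)

/-- `⨁ (Q⁻¹ Iᵢ) xᵢ` is a decomposition of `Q⁻¹ Λ`. -/
lemma IsDecomposition.fracIdeal_smul {Λ : Submodule (𝓞 K) V} {x : Module.Basis (Fin n) K V}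
    {I : Fin n → FracIdeal K} (h : IsDecomposition Λ x I) (R : FracIdeal K) :
    IsDecomposition (((R : FractionalIdeal (𝓞 K)⁰ K) : Submodule (𝓞 K) K) • Λ) x
      (fun i => R * I i) := by
  intro v
  constructor
  · intro hv
    refine Submodule.smul_induction_on hv ?_ ?_
    · intro q hq v hv i
      rw [map_smul]
      exact mul_mem_fracIdeal hq ((h v).1 hv i)
    · intro v w hv hw i
      rw [map_add]
      have := Submodule.add_mem _ (hv i) (hw i)
      exact this
  · intro hv
    rw [← x.sum_repr v]
    refine Submodule.sum_mem _ fun i _ => ?_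
    have hi := hv i
    rw [Units.val_mul] at hi
    refine FractionalIdeal.mul_induction_on hi ?_ ?_
    · intro q hq b hb
      rw [mul_smul]
      exact Submodule.smul_mem_smul hq (h.smul_mem i hb)
    · intro c d hc hd
      rw [add_smul]
      exact Submodule.add_mem _ hc hd

end Lattices

/-! ### Comparison of forms along different paths -/

/-- The matrices `diag(ε⁻¹ N, ᵗN⁻¹)`, with a totally positive unit `ε` and with `N` in the
stabilizer of `⨁ Iᵢ`, belong to `Γ(I₁, …, Iₙ; J)`. -/
lemma fromBlocks_mem_Gam {ε : Kˣ} (hε : TotPos (ε : K)) (hε1 : toPrincipalIdeal (𝓞 K) K ε = 1)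
    {N : GL (Fin n) K} {I : Fin n → FracIdeal K} (J : FracIdeal K) (hN : EntriesIn N.1 I I)
    (hN' : EntriesIn (N⁻¹).1 I I) :
    Matrix.fromBlocks ((ε : K)⁻¹ • N.1) 0 0 (N.1)⁻¹.transpose ∈ Gam I J := by
  have hε1' : toPrincipalIdeal (𝓞 K) K ε⁻¹ = 1 := by rw [map_inv, hε1, inv_one]
  have hmem : ((ε : Kˣ) : K) ∈ ((1 : FracIdeal K) : FractionalIdeal (𝓞 K)⁰ K) :=
    hε1 ▸ mem_toPrincipalIdeal_self ε
  have hmem' : ((ε⁻¹ : Kˣ) : K) ∈ ((1 : FracIdeal K) : FractionalIdeal (𝓞 K)⁰ K) :=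
    hε1' ▸ mem_toPrincipalIdeal_self ε⁻¹
  have hmul : N.1 * (N.1)⁻¹ = 1 := by
    rw [← Matrix.coe_units_inv, ← Units.val_mul, mul_inv_cancel, Units.val_one]
  have hmul' : (N.1)⁻¹ * N.1 = 1 := by
    rw [← Matrix.coe_units_inv, ← Units.val_mul, inv_mul_cancel, Units.val_one]
  refine ⟨?_, ?_, ?_, ?_, fun i j => ⟨?_, ?_, ?_, ?_⟩⟩
  · refine IsUnit.of_mul_eq_one (Matrix.fromBlocks ((ε : K) • (N.1)⁻¹) 0 0 N.1.transpose) ?_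
    rw [Matrix.fromBlocks_multiply, ← Matrix.transpose_mul, hmul]
    simp [hmul]
  · simp [Matrix.IsSymm]
  · simp [Matrix.IsSymm]
  · rw [Units.val_one, FractionalIdeal.mem_one_iff] at hmem hmem'
    obtain ⟨a, ha⟩ := hmem
    obtain ⟨b, hb⟩ := hmem'
    have hba : b * a = 1 := by
      apply FaithfulSMul.algebraMap_injective (𝓞 K) K
      rw [map_mul, ha, hb, Units.inv_mul, map_one]
    have hb' : (b : K) = (ε : K)⁻¹ := by rw [← Units.val_inv_eq_inv_val, ← hb]
    refine ⟨⟨b, a, hba, by rw [mul_comm, hba]⟩, ?_, ?_⟩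
    · show TotPos (b : K)
      rw [hb']
      exact hε.inv
    · show _ = (b : K) • _
      simp [hb', hmul]
  · rw [Matrix.toBlocks_fromBlocks₁₁, Matrix.smul_apply, smul_eq_mul, ← Units.val_inv_eq_inv_val]
    simpa using mul_mem_fracIdeal hmem' (hN i j)
  · simpa using zero_mem_fracIdeal _
  · simpa using zero_mem_fracIdeal _
  · rw [Matrix.toBlocks_fromBlocks₂₂, Matrix.transpose_apply, mul_comm, ← Matrix.coe_units_inv]
    exact hN' j i

/-- The similitude of a path of maps may be replaced by any other one with the same integrality
properties, since the two differ by an element of the group under which the form at the end is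
invariant. -/
lemma IsTransport.change {k : ℤ} {L L' : LabelledForm K n} {β : Kˣ} {M₀ : GL (Fin n) K}
    (h : IsTransport k L L' β M₀) (hinv : ∀ γ ∈ Gam L'.I L'.J, slash k γ L'.f = L'.f) {δ : Kˣ}
    (hδ : TotPos (δ : K)) (hJ : L'.J = toPrincipalIdeal (𝓞 K) K δ * L.J) {M : GL (Fin n) K}
    (hM : EntriesIn M.1 L.I L'.I) (hM' : EntriesIn (M⁻¹).1 L'.I L.I) :
    IsLeviSlash k δ M L.f L'.f := by
  obtain ⟨hβ, -⟩ := h.isLeviSlash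
  have hε : TotPos ((β⁻¹ * δ : Kˣ) : K) := by
    rw [Units.val_mul, Units.val_inv_eq_inv_val]
    exact hβ.inv.mul hδ
  have hε1 : toPrincipalIdeal (𝓞 K) K (β⁻¹ * δ) = 1 := by
    rw [map_mul, map_inv, inv_mul_eq_one]
    exact mul_right_cancel (h.J_eq.symm.trans hJ)
  have hN : EntriesIn (M₀⁻¹ * M).1 L'.I L'.I := h.entries_inv.mul hM
  have hN' : EntriesIn (M₀⁻¹ * M)⁻¹.1 L'.I L'.I := by
    rw [mul_inv_rev, inv_inv]
    exact hM'.mul h.entries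
  have hs := isLeviSlash_slash k hε (M₀⁻¹ * M) L'.f
  rw [hinv _ (fromBlocks_mem_Gam hε hε1 L'.J hN hN')] at hs
  simpa using h.isLeviSlash.trans hs

/-- The factor of a change of basis is compensated by the norms of the coefficient ideals and of
the ideal `J`. -/
lemma leviFactor_mul_absNorm [IsTotallyReal K] (k : ℤ) {δ : Kˣ} (hδ : TotPos (δ : K))
    {M : GL (Fin n) K} (hM : Odd k → TotPos M.1.det) {P P' : FracIdeal K} (J : FracIdeal K)
    (hP : P = toPrincipalIdeal (𝓞 K) K (Matrix.GeneralLinearGroup.det M) * P') :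
    leviFactor k δ M *
      ((FractionalIdeal.absNorm (P' : FractionalIdeal (𝓞 K)⁰ K) : ℚ) : ℝ) ^ k *
      ((FractionalIdeal.absNorm ((toPrincipalIdeal (𝓞 K) K δ * J : FracIdeal K) :
        FractionalIdeal (𝓞 K)⁰ K) : ℚ) : ℝ) ^ ((n : ℝ) * k / 2) =
      ((FractionalIdeal.absNorm (P : FractionalIdeal (𝓞 K)⁰ K) : ℚ) : ℝ) ^ k *
      ((FractionalIdeal.absNorm (J : FractionalIdeal (𝓞 K)⁰ K) : ℚ) : ℝ) ^ ((n : ℝ) * k / 2) := by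
  have hδ' := realNorm_pos hδ
  have hdet : |realNorm K M.1.det| ^ k = realNorm K M.1.det ^ k := by
    rcases Int.even_or_odd k with hk | hk
    · exact hk.zpow_abs _
    · rw [abs_of_pos (realNorm_pos (hM hk))]
  have hdet' := abs_realNorm (Matrix.GeneralLinearGroup.det M)
  rw [Matrix.GeneralLinearGroup.val_det_apply] at hdet'
  rw [hP, Units.val_mul, Units.val_mul, map_mul, map_mul, Rat.cast_mul, Rat.cast_mul, ← abs_realNorm,
    ← hdet', mul_zpow, hdet, abs_of_pos hδ', Real.mul_rpow hδ'.le
      (by exact_mod_cast FractionalIdeal.absNorm_nonneg _), leviFactor, Real.rpow_neg hδ'.le]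
  have h0 : realNorm K (δ : K) ^ ((n : ℝ) * k / 2) ≠ 0 := (Real.rpow_pos_of_pos hδ' _).ne'
  field_simp

/-! ### The Fourier coefficient of a lattice -/

section Lattices

variable {V : Type*} [AddCommGroup V] [Module K V] [Module (𝓞 K) V]

/-- All values of the Fourier coefficient of `Λ`, for `J` and for `δ J` with the form scaled by
`δ⁻¹`, agree. -/
theorem IsFourierCoeff.eq [IsTotallyReal K] (hn : 1 ≤ n) {k : ℤ} {F : Family K n k}
    {B : LinearMap.BilinForm K V} {Λ : Submodule (𝓞 K) V} {ω : Odd k → VOrientation K n V}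
    {J : FracIdeal K} {δ : Kˣ} (hδ : TotPos (δ : K)) {z z' : ℂ}
    (h : IsFourierCoeff F B Λ ω J z)
    (h' : IsFourierCoeff F ((δ : K)⁻¹ • B) Λ ω (toPrincipalIdeal (𝓞 K) K δ * J) z') : z = z' := by
  obtain ⟨x, I, f, a, hx, hΛ, -, hf, ha, rfl⟩ := h
  obtain ⟨x', I', f', a', hx', hΛ', hmod', hf', ha', rfl⟩ := h'
  let M : GL (Fin n) K := ⟨x.toMatrix x', x'.toMatrix x, x.toMatrix_mul_toMatrix_flip x',
    x'.toMatrix_mul_toMatrix_flip x⟩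
  have hM : EntriesIn M.1 I I' := hΛ.entriesIn hΛ'
  have hM' : EntriesIn (M⁻¹).1 I' I := hΛ'.entriesIn hΛ
  have hprod := prod_eq_toPrincipalIdeal_det_mul hM hM'
  have hpos : Odd k → TotPos M.1.det := fun hk =>
    Quotient.exact ((hx hk).trans (hx' hk).symm)
  -- The Steinitz classes agree, so the maps `U_l`, `V_l` lead from `I` to `I'`, and `W(δ)` from `J`
  -- to `δ J`. This is a path from the component at `(I; J)` to the one at `(I'; δ J)`.
  have hpath : Equivalent k ⟨I, J, F.comp I J⟩ ⟨I', toPrincipalIdeal (𝓞 K) K δ * J,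
      F.comp I' (toPrincipalIdeal (𝓞 K) K δ * J)⟩ := by
    apply F.equivalent
    obtain ⟨g, hg⟩ := exists_equivalent k hn I I' J (F.comp I J)
      (Matrix.GeneralLinearGroup.det M)⁻¹ (by rw [hprod, map_inv, inv_mul_cancel_left])
    exact ⟨_, hg.tail (Step.W I' J g δ hδ)⟩
  obtain ⟨β₁, M₁, h₁⟩ := hf.exists_isTransport
  have hpath' : Equivalent k ⟨I, J, F.comp I J⟩ ⟨I', toPrincipalIdeal (𝓞 K) K δ * J, f'⟩ :=
    hpath.trans hf'
  obtain ⟨β₂, M₂, h₂⟩ := hpath'.exists_isTransport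
  have hslash : IsLeviSlash k δ M f f' :=
    (h₁.symm.trans h₂).change hmod'.slash_eq hδ rfl hM hM'
  have hT : indexEquiv δ M (Matrix.of fun i j => B (x i) (x j)) =
      Matrix.of fun i j => ((δ : K)⁻¹ • B) (x' i) (x' j) := by
    have hB := LinearMap.BilinForm.toMatrix_mul_basis_toMatrix x x' B
    have hmat : Matrix.of (fun i j => B (x i) (x j)) = LinearMap.BilinForm.toMatrix x B := by
      ext i j
      rw [LinearMap.BilinForm.toMatrix_apply, Matrix.of_apply]
    rw [hmat]
    ext i j
    have hij := congrFun (congrFun hB i) j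
    rw [LinearMap.BilinForm.toMatrix_apply] at hij
    simp only [indexEquiv, Equiv.coe_fn_mk, Matrix.smul_apply, Matrix.of_apply,
      LinearMap.smul_apply, ← hij, M]
  rw [← hT, ha.apply_indexEquiv ha' hslash]
  have hfac := congrArg (fun r : ℝ => (r : ℂ)) (leviFactor_mul_absNorm k hδ hpos J hprod)
  simp only [Complex.ofReal_mul, Complex.ofReal_zpow, Complex.ofReal_ratCast] at hfac
  rw [mul_assoc, ← hfac]
  ring

/-- The Fourier coefficient has a value as soon as `Λ` has a decomposition. -/
theorem exists_isFourierCoeff (hn : 1 ≤ n) {k : ℤ} (F : Family K n k)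
    (B : LinearMap.BilinForm K V) {Λ : Submodule (𝓞 K) V} (ω : Odd k → VOrientation K n V)
    (J : FracIdeal K) {x : Module.Basis (Fin n) K V} {I : Fin n → FracIdeal K}
    (h : IsDecomposition Λ x I) : ∃ z, IsFourierCoeff F B Λ ω J z := by
  obtain ⟨x, I, hx, h⟩ := h.exists_oriented_of_odd hn ω
  obtain ⟨a, ha⟩ := (F.isModularForm I J).expansion
  exact ⟨_, x, I, F.comp I J, a, hx, h, F.isModularForm I J, Relation.ReflTransGen.refl, ha, rfl⟩

lemma IsFourierCoeff.unique [IsTotallyReal K] (hn : 1 ≤ n) {k : ℤ} {F : Family K n k}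
    {B : LinearMap.BilinForm K V} {Λ : Submodule (𝓞 K) V} {ω : Odd k → VOrientation K n V}
    {J : FracIdeal K} {z z' : ℂ} (h : IsFourierCoeff F B Λ ω J z)
    (h' : IsFourierCoeff F B Λ ω J z') : z = z' :=
  h.eq (δ := 1) hn (by simpa using totPos_one) (by simpa using h')

theorem isFourierCoeff_iff [IsTotallyReal K] (hn : 1 ≤ n) {k : ℤ} (F : Family K n k)
    (B : LinearMap.BilinForm K V) {Λ : Submodule (𝓞 K) V} (ω : Odd k → VOrientation K n V)
    (J : FracIdeal K) {x : Module.Basis (Fin n) K V} {I : Fin n → FracIdeal K}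
    (hΛ : IsDecomposition Λ x I) {δ : Kˣ} (hδ : TotPos (δ : K)) (z : ℂ) :
    IsFourierCoeff F B Λ ω J z ↔
      IsFourierCoeff F ((δ : K)⁻¹ • B) Λ ω (toPrincipalIdeal (𝓞 K) K δ * J) z := by
  obtain ⟨z₀, h₀⟩ := exists_isFourierCoeff hn F B ω J hΛ
  obtain ⟨z₁, h₁⟩ := exists_isFourierCoeff hn F ((δ : K)⁻¹ • B) ω
    (toPrincipalIdeal (𝓞 K) K δ * J) hΛ
  obtain rfl : z₀ = z₁ := h₀.eq hn hδ h₁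
  constructor
  · intro h
    rwa [h.unique hn h₀]
  · intro h
    rwa [h.unique hn h₁]

/-- The tuples `(Q⁻¹ I₁, …, Q⁻¹ Iₙ; Q² J)` and `(I₁, …, Iₙ; J)` define the same group. -/
lemma Gam_inv_mul (I : Fin n → FracIdeal K) (J Q : FracIdeal K) :
    Gam (fun i => Q⁻¹ * I i) (Q ^ 2 * J) = Gam I J := by
  have h₁ : ∀ i j, Q⁻¹ * I i * (Q⁻¹ * I j)⁻¹ = I i * (I j)⁻¹ := fun i j => by
    rw [mul_inv_rev, inv_inv, mul_comm (I j)⁻¹, ← mul_assoc, mul_right_comm Q⁻¹, inv_mul_cancel,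
      one_mul]
  have h₂ : ∀ i j, Q⁻¹ * I i * (Q⁻¹ * I j) * (Q ^ 2 * J) = I i * I j * J := fun i j => by
    rw [mul_mul_mul_comm Q⁻¹, mul_mul_mul_comm, ← mul_inv, ← pow_two, inv_mul_cancel, one_mul]
  have h₃ : ∀ i j, (Q⁻¹ * I i)⁻¹ * (Q⁻¹ * I j) = (I i)⁻¹ * I j := fun i j => by
    rw [mul_comm, h₁, mul_comm]
  simp only [Gam, h₁, h₂, h₃]

/-- `Λ` with `J` and `Q⁻¹ Λ` with `Q² J` have a value of the Fourier coefficient in common: it comes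
from the form that `F` assigns to the two tuples, which define the same group. -/
lemma exists_isFourierCoeff_inv_smul [IsScalarTower (𝓞 K) K V] (hn : 1 ≤ n) {k : ℤ} (F : Mk K n k)
    (B : LinearMap.BilinForm K V) {Λ : Submodule (𝓞 K) V} (ω : Odd k → VOrientation K n V)
    (J Q : FracIdeal K) {x : Module.Basis (Fin n) K V} {I : Fin n → FracIdeal K}
    (h : IsDecomposition Λ x I) :
    ∃ z, IsFourierCoeff F.toFamily B Λ ω J z ∧ IsFourierCoeff F.toFamily B
      ((((Q⁻¹ : FracIdeal K) : FractionalIdeal (𝓞 K)⁰ K) : Submodule (𝓞 K) K) • Λ) ω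
      (Q ^ 2 * J) z := by
  obtain ⟨x, I, hx, h⟩ := h.exists_oriented_of_odd hn ω
  obtain ⟨a, ha⟩ := (F.isModularForm I J).expansion
  have hcomp := F.comp_eq _ _ _ _ (Gam_inv_mul I J Q)
  refine ⟨_, ⟨x, I, F.comp I J, a, hx, h, F.isModularForm I J, Relation.ReflTransGen.refl, ha,
    rfl⟩, ⟨x, _, _, a, hx, h.fracIdeal_smul Q⁻¹, F.isModularForm _ _, Relation.ReflTransGen.refl,
    hcomp ▸ ha, ?_⟩⟩
  have hQ : 0 < ((FractionalIdeal.absNorm (Q : FractionalIdeal (𝓞 K)⁰ K) : ℚ) : ℝ) := by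
    have h1 := FractionalIdeal.absNorm_nonneg (Q : FractionalIdeal (𝓞 K)⁰ K)
    have h2 : FractionalIdeal.absNorm (Q : FractionalIdeal (𝓞 K)⁰ K) ≠ 0 := fun h =>
      Q.ne_zero (FractionalIdeal.absNorm_eq_zero_iff.1 h)
    exact_mod_cast lt_of_le_of_ne h1 h2.symm
  have hQI : ((FractionalIdeal.absNorm ((∏ i, Q⁻¹ * I i : FracIdeal K) :
      FractionalIdeal (𝓞 K)⁰ K) : ℚ) : ℝ) =
      (((FractionalIdeal.absNorm (Q : FractionalIdeal (𝓞 K)⁰ K) : ℚ) : ℝ) ^ n)⁻¹ *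
        ((FractionalIdeal.absNorm ((∏ i, I i : FracIdeal K) :
          FractionalIdeal (𝓞 K)⁰ K) : ℚ) : ℝ) := by
    rw [eq_inv_mul_iff_mul_eq₀ (pow_pos hQ n).ne', ← Rat.cast_pow, ← map_pow, ← Rat.cast_mul,
      ← map_mul, ← Units.val_pow_eq_pow_val, ← Units.val_mul, Finset.prod_mul_distrib]
    simp
  have hJ : 0 ≤ ((FractionalIdeal.absNorm (J : FractionalIdeal (𝓞 K)⁰ K) : ℚ) : ℝ) := by
    exact_mod_cast FractionalIdeal.absNorm_nonneg _
  have key : ((FractionalIdeal.absNorm ((∏ i, I i : FracIdeal K) :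
      FractionalIdeal (𝓞 K)⁰ K) : ℚ) : ℝ) ^ k *
      ((FractionalIdeal.absNorm (J : FractionalIdeal (𝓞 K)⁰ K) : ℚ) : ℝ) ^ ((n : ℝ) * k / 2) =
      ((FractionalIdeal.absNorm ((∏ i, Q⁻¹ * I i : FracIdeal K) :
      FractionalIdeal (𝓞 K)⁰ K) : ℚ) : ℝ) ^ k *
      ((FractionalIdeal.absNorm ((Q ^ 2 * J : FracIdeal K) : FractionalIdeal (𝓞 K)⁰ K) : ℚ) : ℝ)
        ^ ((n : ℝ) * k / 2) := by
    rw [hQI, Units.val_mul, Units.val_pow_eq_pow_val, map_mul, map_pow, Rat.cast_mul, Rat.cast_pow,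
      Real.mul_rpow (pow_nonneg hQ.le 2) hJ, mul_zpow]
    set q := ((FractionalIdeal.absNorm (Q : FractionalIdeal (𝓞 K)⁰ K) : ℚ) : ℝ)
    have h1 : (q ^ 2) ^ ((n : ℝ) * k / 2) = (q ^ n) ^ k := by
      rw [← Real.rpow_natCast, ← Real.rpow_mul hQ.le, ← Real.rpow_natCast q n,
        ← Real.rpow_intCast, ← Real.rpow_mul hQ.le]
      congr 1
      push_cast
      ring
    have h2 : (q ^ n) ^ k ≠ 0 := zpow_ne_zero _ (pow_pos hQ n).ne'
    rw [h1, inv_zpow]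
    field_simp
  have hkey := congrArg (fun r : ℝ => (r : ℂ)) key
  simp only [Complex.ofReal_mul, Complex.ofReal_zpow, Complex.ofReal_ratCast] at hkey
  rw [mul_assoc, hkey, ← mul_assoc]

end Lattices

end HilbertSiegel

end

theorem proposition2p2
    {K : Type*} [Field K] [NumberField K] [NumberField.IsTotallyReal K]
    {n : ℕ} (hn : 1 < n) (k : ℤ)
    {V : Type*} [AddCommGroup V] [Module K V] [Module (𝓞 K) V] [IsScalarTower (𝓞 K) K V]
    (hV : Module.finrank K V = n)
    (B : LinearMap.BilinForm K V) (hB : B.IsSymm)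
    (hpos : ∀ (σ : K →+* ℝ) (v : V), 0 ≤ σ (B v v))
    (Λ : Submodule (𝓞 K) V) [Submodule.IsLattice K Λ]
    (ω : Odd k → HilbertSiegel.VOrientation K n V)
    (J : HilbertSiegel.FracIdeal K) (heven : HilbertSiegel.IsEvenIntegral B Λ J) :
    (∀ F : HilbertSiegel.Family K n k,
      (∃! z : ℂ, HilbertSiegel.IsFourierCoeff F B Λ ω J z) ∧
      ∀ α : Kˣ, HilbertSiegel.TotPos (α : K) → ∀ z : ℂ,
        (HilbertSiegel.IsFourierCoeff F B Λ ω J z ↔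
          HilbertSiegel.IsFourierCoeff F ((α : K)⁻¹ • B) Λ ω
            (toPrincipalIdeal (𝓞 K) K α * J) z)) ∧
    (∀ F : HilbertSiegel.Mk K n k,
      (∃! z : ℂ, HilbertSiegel.IsFourierCoeff F.toFamily B Λ ω J z) ∧
      ∀ (α : Kˣ) (Q : HilbertSiegel.FracIdeal K), HilbertSiegel.TotPos (α : K) → ∀ z : ℂ,
        (HilbertSiegel.IsFourierCoeff F.toFamily B Λ ω J z ↔
          HilbertSiegel.IsFourierCoeff F.toFamily ((α : K)⁻¹ • B)
            ((((Q⁻¹ : HilbertSiegel.FracIdeal K) : FractionalIdeal (𝓞 K)⁰ K) :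
              Submodule (𝓞 K) K) • Λ) ω
            (toPrincipalIdeal (𝓞 K) K α * Q ^ 2 * J) z)) := by
  have hn1 : 1 ≤ n := hn.le
  have : Module.Finite K V := Module.finite_of_finrank_pos (by omega)
  obtain ⟨x, I, hΛ⟩ := HilbertSiegel.exists_isDecomposition_of_fg n hV Λ Submodule.IsLattice.fg
    (HilbertSiegel.exists_smul_mem_of_isLattice Λ)
  have hunique : ∀ F : HilbertSiegel.Family K n k,
      ∃! z : ℂ, HilbertSiegel.IsFourierCoeff F B Λ ω J z := fun F => by
    obtain ⟨z, hz⟩ := HilbertSiegel.exists_isFourierCoeff hn1 F B ω J hΛ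
    exact ⟨z, hz, fun z' hz' => hz'.unique hn1 hz⟩
  refine ⟨fun F => ⟨hunique F, fun α hα z =>
    HilbertSiegel.isFourierCoeff_iff hn1 F B ω J hΛ hα z⟩, fun F => ⟨hunique F.toFamily,
    fun α Q hα z => ?_⟩⟩
  rw [mul_assoc, ← HilbertSiegel.isFourierCoeff_iff hn1 F.toFamily B ω (Q ^ 2 * J)
    (hΛ.fracIdeal_smul Q⁻¹) hα z]
  obtain ⟨z₀, h₀, h₁⟩ := HilbertSiegel.exists_isFourierCoeff_inv_smul hn1 F B ω J Q hΛ
  constructor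
  · intro h
    rwa [h.unique hn1 h₀]
  · intro h
    rwa [h.unique hn1 h₁]
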